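/- Extended double shuffle relations for interpolated multiple zeta values. Notation. Let $\mathfrak h_t=\mathbb Q[t]\langle x,y\rangle$ be the algebra of noncommutative polynomials over $\mathbb Q[t]$, $\mathfrak h_t^1=\mathbb Q[t]+\mathfrak h_t y$, $\mathfrak h_t^0=\mathbb Q[t]+x\mathfrak h_t y$, and $z_k=x^{k-1}y$ for $k\ge 1$. For positive integers $k_1,\dots,k_n$ with $k_1\ge 2$ put $$\zeta(k_1,\dots,k_n)=\sum_{m_1>\cdots>m_n>0}\frac1{m_1^{k_1}\cdots m_n^{k_n}},\qquad \zeta^t(k_1,\dots,k_n)=\sum_{\mathbf p}t^{\,n-\mathrm{dep}(\mathbf p)}\zeta(\mathbf p)\in\mathbb R[t],$$ where $\mathbf p$ runs over all sequences $(k_1\Box\cdots\Box k_n)$ with each $\Box$ filled by a comma or a plus sign, and $\mathrm{dep}(\mathbf p)$ is the length of $\mathbf p$. Let $Z_t:\mathfrak h_t^0\to\mathbb R[t]$ be the $\mathbb Q[t]$-linear map with $Z_t(1)=1$ and $Z_t(z_{k_1}\cdots z_{k_n})=\zeta^t(k_1,\dots,k_n)$ for $k_1\ge2$. For a word $w$ let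 $\delta(w)=1$ if $w=1$ and $\delta(w)=0$ otherwise, and let $\rho(x)=0$, $\rho(y)=tx$. The $t$-shuffle product $\mathbin{\mathrm{sh}_t}$ on $\mathfrak h_t$ is the $\mathbb Q[t]$-bilinear product with $1\mathbin{\mathrm{sh}_t}w=w\mathbin{\mathrm{sh}_t}1=w$ and $$aw_1\mathbin{\mathrm{sh}_t}bw_2=a(w_1\mathbin{\mathrm{sh}_t}bw_2)+b(aw_1\mathbin{\mathrm{sh}_t}w_2)-\delta(w_1)\rho(a)bw_2-\delta(w_2)\rho(b)aw_1$$ for letters $a,b$ and words $w,w_1,w_2$; it maps $\mathfrak h_t^1\times\mathfrak h_t^1$ to $\mathfrak h_t^1$. The $t$-harmonic shuffle product $\mathbin{*_t}$ on $\mathfrak h_t^1$ is the $\mathbb Q[t]$-bilinear product with $1\mathbin{*_t}w=w\mathbin{*_t}1=w$ and $$z_kw_1\mathbin{*_t}z_lw_2=z_k(w_1\mathbin{*_t}z_lw_2)+z_l(z_kw_1\mathbin{*_t}w_2)+(1-2t)z_{k+l}(w_1\mathbin{*_t}w_2)+(1-\delta(w_1)\delta(w_2))(t^2-t)x^{k+l}(w_1\mathbin{*_t}w_2)$$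 for $k,l\ge1$ and words $w,w_1,w_2\in\mathfrak h_t^1$. Theorem. There are unique $\mathbb Q[t]$-algebra homomorphisms $Z_t^{\mathrm{sh}}:(\mathfrak h_t^1,\mathbin{\mathrm{sh}_t})\to\mathbb R[t,T]$ and $Z_t^{*}:(\mathfrak h_t^1,\mathbin{*_t})\to\mathbb R[t,T]$ such that $Z_t^{\mathrm{sh}}|_{\mathfrak h_t^0}=Z_t=Z_t^{*}|_{\mathfrak h_t^0}$ and $Z_t^{\mathrm{sh}}(y)=Z_t^{*}(y)=T$. For all $w_1\in\mathfrak h_t^1$ and $w_0\in\mathfrak h_t^0$ they satisfy $$Z_t^{\mathrm{sh}}\bigl(w_1\mathbin{\mathrm{sh}_t}w_0-w_1\mathbin{*_t}w_0\bigr)=0\qquad\text{and}\qquad Z_t^{*}\bigl(w_1\mathbin{\mathrm{sh}_t}w_0-w_1\mathbin{*_t}w_0\bigr)=0.$$ -/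

import Mathlib

open Polynomial

namespace TMZV

noncomputable section

/-! ### The algebra of noncommutative polynomials in two letters over `ℚ[t]` -/

/-- The alphabet `A = {x, y}`. -/
inductive Letter where
  | x : Letter
  | y : Letter

/-- The noncommutative polynomial algebra `𝔥_t = ℚ[t]⟨x, y⟩`; the variable `t` is `X : ℚ[X]`. -/
abbrev H : Type := FreeAlgebra ℚ[X] Letter

/-- A letter as an element of `𝔥_t`. -/
def letter (a : Letter) : H := FreeAlgebra.ι ℚ[X] a

/-- A word as an element of `𝔥_t`; the empty word is `1`. -/
def word (w : List Letter) : H := (w.map letter).prod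

/-- The basis of `𝔥_t` consisting of the words. -/
def wordBasis : Module.Basis (List Letter) ℚ[X] H := FreeAlgebra.basisFreeMonoid ℚ[X] Letter

theorem wordBasis_apply (w : List Letter) : wordBasis w = word w := by
  have h : ∀ v : FreeMonoid Letter, FreeAlgebra.basisFreeMonoid ℚ[X] Letter v
      = (FreeAlgebra.equivMonoidAlgebraFreeMonoid (R := ℚ[X]) (X := Letter)).symm
          (MonoidAlgebra.of _ _ v) := fun v => rfl
  refine (h w).trans ?_
  change MonoidAlgebra.lift ℚ[X] (FreeAlgebra ℚ[X] Letter) (FreeMonoid Letter)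
    (FreeMonoid.lift (FreeAlgebra.ι ℚ[X])) (MonoidAlgebra.of _ _ (FreeMonoid.ofList w)) = _
  rw [MonoidAlgebra.lift_of, FreeMonoid.lift_ofList]
  rfl

theorem word_induction {P : H → Prop} (h0 : P 0) (hadd : ∀ u v, P u → P v → P (u + v))
    (hsmul : ∀ (c : ℚ[X]) u, P u → P (c • u)) (hword : ∀ w, P (word w)) (u : H) : P u := by
  have hu : u ∈ Submodule.span ℚ[X] (Set.range wordBasis) := wordBasis.mem_span u
  induction hu using Submodule.span_induction with
  | zero => exact h0
  | add u v _ _ hu hv => exact hadd u v hu hv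
  | smul c u _ hu => exact hsmul c u hu
  | mem u hu =>
    obtain ⟨w, rfl⟩ := hu
    rw [wordBasis_apply]
    exact hword w

theorem word_nil : word [] = 1 := rfl

theorem word_cons (a : Letter) (w : List Letter) : word (a :: w) = letter a * word w := by
  simp [word]

theorem word_append (u v : List Letter) : word (u ++ v) = word u * word v := by
  simp [word]

/-- The left ideal `𝔥_t y`, as a `ℚ[t]`-submodule. -/
def Hy : Submodule ℚ[X] H := LinearMap.range (LinearMap.mulRight ℚ[X] (letter Letter.y))

/-- `𝔥_t¹ = ℚ[t] + 𝔥_t y`. -/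
def H1 : Submodule ℚ[X] H := Submodule.span ℚ[X] {1} ⊔ Hy

/-- `𝔥_t⁰ = ℚ[t] + x 𝔥_t y`. -/
def H0 : Submodule ℚ[X] H :=
  Submodule.span ℚ[X] {1} ⊔
    LinearMap.range (LinearMap.mulLeft ℚ[X] (letter Letter.x) ∘ₗ
      LinearMap.mulRight ℚ[X] (letter Letter.y))

theorem mul_y_mem_Hy (u : H) : u * letter Letter.y ∈ Hy := ⟨u, rfl⟩

theorem mul_mem_Hy (u : H) {v : H} (hv : v ∈ Hy) : u * v ∈ Hy := by
  obtain ⟨v, rfl⟩ := hv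
  exact ⟨u * v, by simp [mul_assoc]⟩

theorem Hy_le_H1 : Hy ≤ H1 := le_sup_right

theorem one_mem_H1 : (1 : H) ∈ H1 :=
  Submodule.mem_sup_left (Submodule.subset_span rfl)

theorem H0_le_H1 : H0 ≤ H1 := by
  refine sup_le le_sup_left ?_
  rintro _ ⟨u, rfl⟩
  refine Hy_le_H1 ?_
  simpa using mul_mem_Hy (letter Letter.x) (mul_y_mem_Hy u)

/-- The letter `y` as an element of `𝔥_t¹`. -/
def yH1 : H1 := ⟨letter Letter.y, Hy_le_H1 (by simpa using mul_y_mem_Hy 1)⟩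

/-- An element of `𝔥_t⁰` as an element of `𝔥_t¹`. -/
def toH1 (w : H0) : H1 := ⟨w, H0_le_H1 w.2⟩

/-! ### The `t`-shuffle product -/

/-- `δ(w)` is `1` for the empty word and `0` for the other words. -/
def delta {α : Type} : List α → ℚ[X]
  | [] => 1
  | _ :: _ => 0

/-- `ρ(x) = 0`, `ρ(y) = t x`. -/
def rho : Letter → H
  | Letter.x => 0
  | Letter.y => (X : ℚ[X]) • letter Letter.x

/-- The `t`-shuffle product of two words. -/
def tshuffleWord : List Letter → List Letter → H
  | [], v => word v
  | u, [] => word u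
  | a :: u, b :: v =>
      letter a * tshuffleWord u (b :: v) + letter b * tshuffleWord (a :: u) v
        - delta u • (rho a * word (b :: v)) - delta v • (rho b * word (a :: u))
  termination_by u v => u.length + v.length

/-- The `t`-shuffle product on `𝔥_t`: the `ℚ[t]`-bilinear extension of `tshuffleWord`. -/
def tshuffleH : H →ₗ[ℚ[X]] H →ₗ[ℚ[X]] H :=
  wordBasis.constr ℚ[X] fun u => wordBasis.constr ℚ[X] fun v => tshuffleWord u v

theorem tshuffleH_word (u v : List Letter) :
    tshuffleH (word u) (word v) = tshuffleWord u v := by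
  rw [← wordBasis_apply, ← wordBasis_apply, tshuffleH, Module.Basis.constr_basis,
    Module.Basis.constr_basis]

/-! ### The `t`-harmonic shuffle product -/

/-- The word `z_k = x^(k-1) y` for `k ≥ 1`. -/
def zWord (k : ℕ+) : List Letter := List.replicate ((k : ℕ) - 1) Letter.x ++ [Letter.y]

/-- `z_k` as an element of `𝔥_t`. -/
def z (k : ℕ+) : H := word (zWord k)

/-- The word `z_{k₁} ⋯ z_{kₙ}` attached to an index `(k₁, …, kₙ)`. -/
def indexWord (k : List ℕ+) : List Letter := k.flatMap zWord

/-- Auxiliary function for `toIndex`: `c - 1` letters `x` have been read since the last `y`. -/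
def toIndexAux : ℕ+ → List Letter → List ℕ+
  | _, [] => []
  | c, Letter.x :: w => toIndexAux (c + 1) w
  | c, Letter.y :: w => c :: toIndexAux 1 w

/-- The index `(k₁, …, kₙ)` of a word `z_{k₁} ⋯ z_{kₙ}` (for a word that ends in `x`, the trailing
letters `x` are disregarded). -/
def toIndex (w : List Letter) : List ℕ+ := toIndexAux 1 w

theorem toIndexAux_replicate (n : ℕ) (c : ℕ+) (w : List Letter) :
    toIndexAux c (List.replicate n Letter.x ++ Letter.y :: w)
      = ⟨(c : ℕ) + n, by positivity⟩ :: toIndexAux 1 w := by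
  induction n generalizing c with
  | zero => rfl
  | succ n ih =>
    rw [List.replicate_succ, List.cons_append, toIndexAux, ih]
    congr 1
    apply PNat.eq
    simp only [PNat.mk_coe, PNat.add_coe, PNat.one_coe]
    omega

theorem toIndex_indexWord (k : List ℕ+) : toIndex (indexWord k) = k := by
  induction k with
  | nil => rfl
  | cons k l ih =>
    have h : indexWord (k :: l)
        = List.replicate ((k : ℕ) - 1) Letter.x ++ Letter.y :: indexWord l := by
      simp [indexWord, zWord]
    rw [toIndex, h, toIndexAux_replicate]
    congr 1
    apply PNat.eq
    have := k.pos
    simp only [PNat.mk_coe, PNat.one_coe]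
    omega

/-- The `t`-harmonic shuffle product of the words attached to two indices. -/
def tastIndex : List ℕ+ → List ℕ+ → H
  | [], q => word (indexWord q)
  | p, [] => word (indexWord p)
  | k :: p, l :: q =>
      z k * tastIndex p (l :: q) + z l * tastIndex (k :: p) q
        + (1 - 2 * X : ℚ[X]) • (z (k + l) * tastIndex p q)
        + ((1 - delta p * delta q) * (X ^ 2 - X) : ℚ[X]) •
            (letter Letter.x ^ ((k + l : ℕ+) : ℕ) * tastIndex p q)
  termination_by p q => p.length + q.length

/-- The `ℚ[t]`-bilinear map on `𝔥_t` given on words by `tastIndex`. Only its restriction to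
`𝔥_t¹` is meaningful. -/
def tastH : H →ₗ[ℚ[X]] H →ₗ[ℚ[X]] H :=
  wordBasis.constr ℚ[X] fun u => wordBasis.constr ℚ[X] fun v => tastIndex (toIndex u) (toIndex v)

theorem tastH_word (p q : List ℕ+) :
    tastH (word (indexWord p)) (word (indexWord q)) = tastIndex p q := by
  rw [← wordBasis_apply, ← wordBasis_apply, tastH, Module.Basis.constr_basis,
    Module.Basis.constr_basis, toIndex_indexWord, toIndex_indexWord]

/-! ### `𝔥_t¹` is closed under both products -/

theorem word_mem_Hy {w : List Letter} (hw : w.getLast? = some Letter.y) : word w ∈ Hy := by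
  obtain ⟨u, rfl⟩ := List.getLast?_eq_some_iff.mp hw
  rw [word_append]
  simpa [word] using mul_y_mem_Hy (word u)

theorem tshuffleWord_mem_Hy (u v : List Letter) (hu : u.getLast? = some Letter.y)
    (hv : v.getLast? = some Letter.y) : tshuffleWord u v ∈ Hy := by
  match u, v with
  | [], _ => simp at hu
  | _ :: _, [] => simp at hv
  | a :: u, b :: v =>
    have h1 : tshuffleWord u (b :: v) ∈ Hy := by
      match u with
      | [] => rw [tshuffleWord]; exact word_mem_Hy hv
      | c :: u => exact tshuffleWord_mem_Hy _ _ (by simpa using hu) hv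
    have h2 : tshuffleWord (a :: u) v ∈ Hy := by
      match v with
      | [] => rw [tshuffleWord]; exacts [word_mem_Hy hu, by simp]
      | c :: v => exact tshuffleWord_mem_Hy _ _ hu (by simpa using hv)
    rw [tshuffleWord]
    exact Hy.sub_mem (Hy.sub_mem (Hy.add_mem (mul_mem_Hy _ h1) (mul_mem_Hy _ h2))
      (Hy.smul_mem _ (mul_mem_Hy _ (word_mem_Hy hv))))
      (Hy.smul_mem _ (mul_mem_Hy _ (word_mem_Hy hu)))
  termination_by u.length + v.length

theorem H1_eq_span :
    H1 = Submodule.span ℚ[X] (word '' {w | w = [] ∨ w.getLast? = some Letter.y}) := by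
  apply le_antisymm
  · refine sup_le (Submodule.span_le.mpr ?_) ?_
    · rintro _ rfl
      exact Submodule.subset_span ⟨[], Or.inl rfl, rfl⟩
    · rintro _ ⟨u, rfl⟩
      induction u using word_induction with
      | h0 => simp
      | hadd u v hu hv => rw [map_add]; exact Submodule.add_mem _ hu hv
      | hsmul c u hu => rw [map_smul]; exact Submodule.smul_mem _ c hu
      | hword w =>
        refine Submodule.subset_span ⟨w ++ [Letter.y], Or.inr (by simp), ?_⟩
        rw [word_append]
        simp [word]
  · refine Submodule.span_le.mpr ?_
    rintro _ ⟨w, rfl | hw, rfl⟩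
    · exact one_mem_H1
    · exact Hy_le_H1 (word_mem_Hy hw)

theorem tshuffleH_mem {u v : H} (hu : u ∈ H1) (hv : v ∈ H1) : tshuffleH u v ∈ H1 := by
  rw [H1_eq_span] at hu hv
  induction hu using Submodule.span_induction with
  | zero => simp
  | add a b _ _ ha hb => rw [map_add]; exact H1.add_mem ha hb
  | smul c a _ ha => rw [map_smul]; exact H1.smul_mem c ha
  | mem a ha =>
    induction hv using Submodule.span_induction with
    | zero => simp
    | add a b _ _ ha hb => rw [map_add]; exact H1.add_mem ha hb
    | smul c a _ ha => rw [map_smul]; exact H1.smul_mem c ha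
    | mem b hb =>
      obtain ⟨p, hp, rfl⟩ := ha
      obtain ⟨q, hq, rfl⟩ := hb
      have key : ∀ w : List Letter, (w = [] ∨ w.getLast? = some Letter.y) → word w ∈ H1 := by
        rintro w (rfl | hw)
        exacts [one_mem_H1, Hy_le_H1 (word_mem_Hy hw)]
      rw [tshuffleH_word]
      rcases hp with rfl | hp
      · rw [tshuffleWord]; exact key q hq
      rcases hq with rfl | hq
      · match p with
        | [] => simp at hp
        | c :: p => rw [tshuffleWord]; exacts [key _ (Or.inr hp), by simp]
      exact Hy_le_H1 (tshuffleWord_mem_Hy p q hp hq)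

theorem z_mem_Hy (k : ℕ+) : z k ∈ Hy := word_mem_Hy (by simp [zWord])

theorem word_indexWord_mem_Hy (k : ℕ+) (p : List ℕ+) : word (indexWord (k :: p)) ∈ Hy := by
  induction p generalizing k with
  | nil => simpa [indexWord, z] using z_mem_Hy k
  | cons l p ih =>
    have h : word (indexWord (k :: l :: p)) = z k * word (indexWord (l :: p)) := by
      rw [z, ← word_append]; simp [indexWord]
    rw [h]
    exact mul_mem_Hy _ (ih l)

theorem tastIndex_mem (p q : List ℕ+) :
    (p = [] ∧ q = [] ∧ tastIndex p q = 1) ∨ ((p ≠ [] ∨ q ≠ []) ∧ tastIndex p q ∈ Hy) := by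
  match p, q with
  | [], [] => left; simp [tastIndex, indexWord, word]
  | [], l :: q => right; simpa [tastIndex] using word_indexWord_mem_Hy l q
  | k :: p, [] => right; simpa [tastIndex] using word_indexWord_mem_Hy k p
  | k :: p, l :: q =>
    right
    refine ⟨by simp, ?_⟩
    have h1 : tastIndex p (l :: q) ∈ Hy := by
      rcases tastIndex_mem p (l :: q) with h | h
      · simp at h
      · exact h.2
    have h2 : tastIndex (k :: p) q ∈ Hy := by
      rcases tastIndex_mem (k :: p) q with h | h
      · simp at h
      · exact h.2
    rw [tastIndex]
    refine Hy.add_mem (Hy.add_mem (Hy.add_mem (mul_mem_Hy _ h1) (mul_mem_Hy _ h2)) ?_) ?_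
    · rcases tastIndex_mem p q with h | h
      · rw [h.2.2, mul_one]; exact Hy.smul_mem _ (z_mem_Hy _)
      · exact Hy.smul_mem _ (mul_mem_Hy _ h.2)
    · rcases tastIndex_mem p q with h | h
      · rw [h.1, h.2.1]; simp [delta]
      · exact Hy.smul_mem _ (mul_mem_Hy _ h.2)
  termination_by p.length + q.length

theorem tastH_mem (u v : H) : tastH u v ∈ H1 := by
  induction u using word_induction with
  | h0 => simp
  | hadd a b ha hb => rw [map_add]; exact H1.add_mem ha hb
  | hsmul c a ha => rw [map_smul]; exact H1.smul_mem c ha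
  | hword p =>
    induction v using word_induction with
    | h0 => simp
    | hadd a b ha hb => rw [map_add]; exact H1.add_mem ha hb
    | hsmul c a ha => rw [map_smul]; exact H1.smul_mem c ha
    | hword q =>
      rw [← wordBasis_apply, ← wordBasis_apply, tastH, Module.Basis.constr_basis, Module.Basis.constr_basis]
      rcases tastIndex_mem (toIndex p) (toIndex q) with h | h
      · rw [h.2.2]; exact one_mem_H1
      · exact Hy_le_H1 h.2

/-- The `t`-shuffle product on `𝔥_t¹`. -/
def tshuffle (u v : H1) : H1 := ⟨tshuffleH u v, tshuffleH_mem u.2 v.2⟩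

/-- The `t`-harmonic shuffle product on `𝔥_t¹`. -/
def tast (u v : H1) : H1 := ⟨tastH u v, tastH_mem u v⟩

/-! ### Interpolated multiple zeta values and the regularized maps -/

/-- The multiple zeta value `ζ(k₁, …, kₙ) = ∑_{m₁ > ⋯ > mₙ > 0} 1 / (m₁^{k₁} ⋯ mₙ^{kₙ})`
(convergent if `n = 0` or `k₁ ≥ 2`; the value at the empty index is `1`). -/
def zeta (k : List ℕ+) : ℝ :=
  ∑' m : {m : Fin k.length → ℕ+ // StrictAnti m},
    ∏ i, 1 / (((m.1 i : ℕ) : ℝ) ^ ((k.get i : ℕ+) : ℕ))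

/-- All the indices `(k₁ □ k₂ □ ⋯ □ kₙ)` where each `□` is filled by a comma or by a plus. -/
def fillings : List ℕ+ → List (List ℕ+)
  | [] => [[]]
  | [k] => [[k]]
  | k :: l :: p => (fillings (l :: p)).map (fun q => k :: q) ++ fillings ((k + l) :: p)
  termination_by p => p.length

/-- The interpolated multiple zeta value `ζ^t(k) = ∑_p t^{n - dep(p)} ζ(p)`, in `ℝ[t]`. -/
def zetaT (k : List ℕ+) : ℝ[X] :=
  ((fillings k).map fun p => (X : ℝ[X]) ^ (k.length - p.length) * C (zeta p)).sum

/-- `ℝ[t]` as an algebra over `ℚ[t]`, in the obvious way (`t ↦ t`). -/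
instance algebraRatRealPoly : Algebra ℚ[X] ℝ[X] := (mapRingHom (algebraMap ℚ ℝ)).toAlgebra

/-- `ℝ[t, T]` is `ℝ[t][T]`: the variable `t` is `C X` and the variable `T` is `X`. Its
`ℚ[t]`-algebra structure is the one with `t ↦ t`. -/
abbrev RtT : Type := ℝ[X][X]

theorem algebraMap_RtT_X : algebraMap ℚ[X] RtT X = C X := by
  rw [Polynomial.algebraMap_apply]
  simp [RingHom.algebraMap_toAlgebra]

/-- The `ℚ[t]`-linear map `Z_t : 𝔥_t⁰ → ℝ[t]` with `Z_t(1) = 1` and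
`Z_t(z_{k₁} ⋯ z_{kₙ}) = ζ^t(k₁, …, kₙ)` for `k₁ ≥ 2`. -/
def Zt : H0 →ₗ[ℚ[X]] ℝ[X] :=
  (wordBasis.constr ℚ[X] fun w => zetaT (toIndex w)).domRestrict H0

theorem Zt_word (k : List ℕ+) (hk : word (indexWord k) ∈ H0) :
    Zt ⟨word (indexWord k), hk⟩ = zetaT k := by
  simp only [Zt, LinearMap.domRestrict_apply]
  rw [← wordBasis_apply, Module.Basis.constr_basis, toIndex_indexWord]

/-- `Z` is a homomorphism of `ℚ[t]`-algebras from `𝔥_t¹`, with the product `mul`, to `ℝ[t, T]`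
that restricts to `Z_t` on `𝔥_t⁰` and maps `y` to `T`. -/
structure IsRegularization (mul : H1 → H1 → H1) (Z : H1 →ₗ[ℚ[X]] RtT) : Prop where
  map_one : Z ⟨1, one_mem_H1⟩ = 1
  map_mul : ∀ u v : H1, Z (mul u v) = Z u * Z v
  restrict : ∀ w : H0, Z (toH1 w) = C (Zt w)
  map_y : Z yH1 = X

end

end TMZV

namespace TMZV

noncomputable section

/-! ### Coefficients of interpolated multiple polylogarithms -/

/-! Both products are realized by one family of series. To a word `w` belongs the interpolated
polylogarithm `∑ coef w n * s ^ n`; at `s = 1` it converges to `Zt w` for `w` in `H0`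
(`hasSum_coef`). Partial sums of the coefficients turn the harmonic product into pointwise
multiplication (`partialSum_tastH`), and power series multiplication realizes the shuffle product
(`genSeries_tshuffleH`).

Existence: for a fixed real value of `t`, the `n`-th partial sum attached to `u` in `H1` is a
polynomial in the harmonic sum `∑_{0<m<n} 1/m`, and the polylogarithm is a polynomial in `-log (1 -
s)`, both up to errors smaller than every negative power of the variable. The variable is the
realization of `y`, so reading it as `T` defines `Zast` and `Zsh`, and uniqueness of expansions
makes them homomorphisms (`IsRealization.exists_regularization`). Only `H0` has to be estimated,
since `H0` and products with `y` generate `H1` (`IsRaising.H1_le`). The same fact gives uniqueness.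

Relations: Abel's theorem links the two realizations, without a comparison map between the
regularizations. The partial sums of `w₁ * w₀` (harmonic product) minus `Zt w₀` times those of `w₁`
tend to `0`, hence so do the corresponding polylogarithms as `s → 1`; thus `Zsh (w₁ * w₀) = Zsh w₁ *
Zt w₀`, which is also the value of `Zsh` at the shuffle product (`polylog_expansion_tast`).
Conversely, if `Zsh u = 0` then `Zast u = 0`: partial sums with a nonconstant expansion tend to
`±∞`, which forbids that the polylogarithm tends to `0`, and a constant is its Abel limit
(`HasExpansion.eq_zero_of_polylogValue`). -/

/-- The `n`-th coefficient of the interpolated multiple polylogarithm attached to a word. -/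
def coefWord : List Letter → ℕ → ℝ[X]
  | [], n => if n = 0 then 1 else 0
  | Letter.x :: w, n => C ((n : ℝ)⁻¹) * coefWord w n
  | Letter.y :: w, n =>
      C ((n : ℝ)⁻¹) * (∑ m ∈ Finset.range n, coefWord w m + X * coefWord w n)

/-- The linear extension of `coefWord`. -/
def coef : H →ₗ[ℚ[X]] (ℕ → ℝ[X]) := wordBasis.constr ℚ[X] coefWord

theorem coef_word (w : List Letter) : coef (word w) = coefWord w := by
  rw [← wordBasis_apply, coef, Module.Basis.constr_basis]

/-- The sum of the first `n` coefficients. -/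
def partialSum : H →ₗ[ℚ[X]] (ℕ → ℝ[X]) where
  toFun u n := ∑ m ∈ Finset.range n, coef u m
  map_add' u v := by
    funext n
    simp [Finset.sum_add_distrib]
  map_smul' c u := by
    funext n
    simp [Finset.smul_sum]

theorem partialSum_apply (u : H) (n : ℕ) :
    partialSum u n = ∑ m ∈ Finset.range n, coef u m := rfl

theorem partialSum_zero (u : H) : partialSum u 0 = 0 := by simp [partialSum_apply]

theorem partialSum_succ (u : H) (n : ℕ) :
    partialSum u (n + 1) = partialSum u n + coef u n := by
  simp [partialSum_apply, Finset.sum_range_succ]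

theorem ratPoly_smul_def (c : ℚ[X]) (p : ℝ[X]) : c • p = c.map (algebraMap ℚ ℝ) * p := rfl

theorem coef_one (n : ℕ) : coef 1 n = if n = 0 then 1 else 0 := by
  rw [← word_nil, coef_word, coefWord]

theorem coef_x_mul (u : H) (n : ℕ) :
    coef (letter Letter.x * u) n = C ((n : ℝ)⁻¹) * coef u n := by
  induction u using word_induction with
  | h0 => simp
  | hadd u v hu hv => simp only [mul_add, map_add, Pi.add_apply, hu, hv]
  | hsmul c u hu =>
    rw [mul_smul_comm, map_smul, map_smul, Pi.smul_apply, Pi.smul_apply, hu, mul_smul_comm]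
  | hword w => rw [← word_cons, coef_word, coef_word, coefWord]

theorem coef_y_mul (u : H) (n : ℕ) :
    coef (letter Letter.y * u) n = C ((n : ℝ)⁻¹) * (partialSum u n + X * coef u n) := by
  induction u using word_induction with
  | h0 => simp
  | hadd u v hu hv => simp only [mul_add, map_add, Pi.add_apply, hu, hv]; ring
  | hsmul c u hu =>
    rw [mul_smul_comm, map_smul, map_smul, map_smul, Pi.smul_apply, Pi.smul_apply, Pi.smul_apply,
      hu, mul_smul_comm, ← smul_add, mul_smul_comm]
  | hword w => rw [← word_cons, coef_word, coef_word, coefWord, partialSum_apply, coef_word]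

theorem coef_x_pow_mul (k : ℕ) (u : H) (n : ℕ) :
    coef (letter Letter.x ^ k * u) n = C ((n : ℝ)⁻¹) ^ k * coef u n := by
  induction k with
  | zero => simp
  | succ k ih => rw [pow_succ', mul_assoc, coef_x_mul, ih, pow_succ']; ring

theorem z_eq (k : ℕ+) : z k = letter Letter.x ^ ((k : ℕ) - 1) * letter Letter.y := by
  simp [z, zWord, word]

theorem coef_z_mul (k : ℕ+) (u : H) (n : ℕ) :
    coef (z k * u) n = C ((n : ℝ)⁻¹) ^ (k : ℕ) * (partialSum u n + X * coef u n) := by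
  rw [z_eq, mul_assoc, coef_x_pow_mul, coef_y_mul, ← mul_assoc, ← pow_succ,
    Nat.sub_add_cancel k.pos]

/-- Each letter divides by `n`, and `0⁻¹ = 0`. This supplies the constant term, which the Euler
derivation does not see. -/
theorem coef_zero_of_mem_Hy {u : H} (hu : u ∈ Hy) : coef u 0 = 0 := by
  obtain ⟨u, rfl⟩ := hu
  induction u using word_induction with
  | h0 => simp
  | hadd u v hu hv => rw [map_add, map_add, Pi.add_apply, hu, hv, add_zero]
  | hsmul c u hu => rw [map_smul, map_smul, Pi.smul_apply, hu, smul_zero]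
  | hword w =>
    cases w with
    | nil =>
      have := coef_y_mul 1 0
      simpa [word_nil] using this
    | cons a w =>
      have h : LinearMap.mulRight ℚ[X] (letter Letter.y) (word (a :: w))
          = letter a * (word w * letter Letter.y) := by
        simp [word_cons, mul_assoc]
      rw [h]
      cases a
      · simp [coef_x_mul]
      · simp [coef_y_mul]

/-! ### Words and indices -/

theorem indexWord_cons (k : ℕ+) (p : List ℕ+) :
    indexWord (k :: p) = zWord k ++ indexWord p := by
  simp [indexWord]

theorem word_indexWord_cons (k : ℕ+) (p : List ℕ+) :
    word (indexWord (k :: p)) = z k * word (indexWord p) := by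
  rw [indexWord_cons, word_append, z]

theorem zWord_one : zWord 1 = [Letter.y] := by simp [zWord]

theorem zWord_add_one (k : ℕ+) : zWord (k + 1) = Letter.x :: zWord k := by
  have := k.pos
  rw [zWord, zWord, ← List.cons_append, ← List.replicate_succ]
  congr 2
  simp only [PNat.add_coe, PNat.one_coe]
  omega

theorem exists_indexWord {w : List Letter} (hw : w = [] ∨ w.getLast? = some Letter.y) :
    ∃ p, w = indexWord p := by
  induction w with
  | nil => exact ⟨[], rfl⟩
  | cons a w ih =>
    simp only [reduceCtorEq, false_or] at hw
    cases a with
    | y =>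
      have hw' : w = [] ∨ w.getLast? = some Letter.y := by
        cases w with
        | nil => exact Or.inl rfl
        | cons b w => exact Or.inr (by simpa using hw)
      obtain ⟨p, rfl⟩ := ih hw'
      exact ⟨1 :: p, by rw [indexWord_cons, zWord_one]; rfl⟩
    | x =>
      cases w with
      | nil => simp at hw
      | cons b w =>
        obtain ⟨p, hp⟩ := ih (Or.inr (by simpa using hw))
        cases p with
        | nil => simp [indexWord] at hp
        | cons k p =>
          exact ⟨(k + 1) :: p, by rw [indexWord_cons, zWord_add_one, hp, indexWord_cons]; rfl⟩

theorem getLast?_indexWord (p : List ℕ+) :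
    indexWord p = [] ∨ (indexWord p).getLast? = some Letter.y := by
  induction p with
  | nil => exact Or.inl rfl
  | cons k p ih =>
    right
    rcases ih with h | h
    · rw [indexWord_cons, h]; simp [zWord]
    · rw [indexWord_cons, List.getLast?_append, h]; rfl

theorem H1_induction {P : H → Prop} (h0 : P 0) (hadd : ∀ u v, P u → P v → P (u + v))
    (hsmul : ∀ (c : ℚ[X]) u, P u → P (c • u)) (hword : ∀ p, P (word (indexWord p)))
    {u : H} (hu : u ∈ H1) : P u := by
  rw [H1_eq_span] at hu
  induction hu using Submodule.span_induction with
  | zero => exact h0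
  | add u v _ _ hu hv => exact hadd u v hu hv
  | smul c u _ hu => exact hsmul c u hu
  | mem u hu =>
    obtain ⟨w, hw, rfl⟩ := hu
    obtain ⟨p, rfl⟩ := exists_indexWord hw
    exact hword p

theorem word_indexWord_mem_H1 (p : List ℕ+) : word (indexWord p) ∈ H1 := by
  cases p with
  | nil => exact one_mem_H1
  | cons k p => exact Hy_le_H1 (word_indexWord_mem_Hy k p)

theorem one_mem_H0 : (1 : H) ∈ H0 := Submodule.mem_sup_left (Submodule.subset_span rfl)

theorem x_mul_mem_H0 {u : H} (hu : u ∈ Hy) : letter Letter.x * u ∈ H0 := by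
  obtain ⟨u, rfl⟩ := hu
  exact Submodule.mem_sup_right ⟨u, by simp⟩

theorem H0_induction {P : H → Prop} (h0 : P 0) (hadd : ∀ u v, P u → P v → P (u + v))
    (hsmul : ∀ (c : ℚ[X]) u, P u → P (c • u)) (hone : P 1)
    (hword : ∀ k p, P (word (indexWord ((k + 1) :: p))))
    {u : H} (hu : u ∈ H0) : P u := by
  obtain ⟨a, ha, b, ⟨v, rfl⟩, rfl⟩ := Submodule.mem_sup.mp hu
  refine hadd _ _ ?_ ?_
  · obtain ⟨c, rfl⟩ := Submodule.mem_span_singleton.mp ha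
    exact hsmul c 1 hone
  · clear hu
    induction v using word_induction with
    | h0 => simpa using h0
    | hadd u v hu hv => rw [map_add]; exact hadd _ _ hu hv
    | hsmul c v hv => rw [map_smul]; exact hsmul _ _ hv
    | hword w =>
      obtain ⟨p, hp⟩ := exists_indexWord (w := w ++ [Letter.y]) (Or.inr (by simp))
      cases p with
      | nil => simp [indexWord] at hp
      | cons k p =>
        convert hword k p using 1
        rw [indexWord_cons, zWord_add_one, List.cons_append, ← indexWord_cons, ← hp]
        simp [word_cons, word_append, word_nil]

/-! ### The harmonic product and partial sums -/

theorem partialSum_one (n : ℕ) : partialSum 1 n = if n = 0 then 0 else 1 := by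
  induction n with
  | zero => simp [partialSum_zero]
  | succ n ih => rw [partialSum_succ, ih, coef_one]; cases n <;> simp

/-- Both sides vanish at `n = 0`; their increments are compared. The increment of a product is `P ΔQ
+ Q ΔP + ΔP ΔQ`. The first two terms of the recursion give `P ΔQ + Q ΔP` plus terms divisible by
`t`, and the coefficients `1 - 2t` and `t² - t` are those that complete these terms to `ΔP ΔQ`. -/
theorem partialSum_tastIndex (p q : List ℕ+) (n : ℕ) :
    partialSum (tastIndex p q) n
      = partialSum (word (indexWord p)) n * partialSum (word (indexWord q)) n := by
  match p, q with
  | [], q =>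
    rw [tastIndex]
    change _ = partialSum 1 n * _
    cases n <;> simp [partialSum_one, partialSum_zero]
  | k :: p, [] =>
    rw [tastIndex]
    · change _ = _ * partialSum 1 n
      cases n <;> simp [partialSum_one, partialSum_zero]
    · simp
  | k :: p, l :: q =>
    induction n with
    | zero => simp [partialSum_zero]
    | succ n ih =>
      have h1 := partialSum_tastIndex p (l :: q)
      have h2 := partialSum_tastIndex (k :: p) q
      have h3 := partialSum_tastIndex p q
      have e1 : coef (tastIndex p (l :: q)) n = _ :=
        eq_sub_of_add_eq' (partialSum_succ _ n).symm
      have e2 : coef (tastIndex (k :: p) q) n = _ :=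
        eq_sub_of_add_eq' (partialSum_succ _ n).symm
      have e3 : coef (tastIndex p q) n = _ :=
        eq_sub_of_add_eq' (partialSum_succ _ n).symm
      -- The factor `1 - δδ` only removes a term that is zero here: `coef 1 n` vanishes for `n > 0`,
      -- and `0⁻¹ = 0` settles `n = 0`.
      have hd : (delta p * delta q).map (algebraMap ℚ ℝ)
          * (C ((n : ℝ)⁻¹) ^ ((k + l : ℕ+) : ℕ) * coef (tastIndex p q) n) = 0 := by
        cases p with
        | cons _ _ => simp [delta]
        | nil =>
          cases q with
          | cons _ _ => simp [delta]
          | nil =>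
            have : tastIndex [] [] = 1 := by simp [tastIndex, indexWord, word_nil]
            rw [this, coef_one]
            rcases Nat.eq_zero_or_pos n with rfl | hn
            · simp
            · simp [hn.ne']
      rw [partialSum_succ, ih, partialSum_succ, partialSum_succ]
      rw [tastIndex]
      simp only [map_add, map_smul, Pi.add_apply, Pi.smul_apply, ratPoly_smul_def,
        coef_z_mul, coef_x_pow_mul, word_indexWord_cons]
      simp only [Polynomial.map_mul, Polynomial.map_sub, Polynomial.map_one, Polynomial.map_pow,
        Polynomial.map_X, Polynomial.map_ofNat] at hd ⊢
      rw [e3] at hd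
      rw [e1, e2, e3]
      simp only [h1, h2, h3, partialSum_succ, word_indexWord_cons, coef_z_mul, PNat.add_coe,
        pow_add] at hd ⊢
      linear_combination (-(X : ℝ[X]) ^ 2 + X) * hd
  termination_by p.length + q.length

theorem partialSum_tastH {u v : H} (hu : u ∈ H1) (hv : v ∈ H1) :
    partialSum (tastH u v) = partialSum u * partialSum v := by
  refine H1_induction (P := fun u => partialSum (tastH u v) = partialSum u * partialSum v)
    (by simp) (fun a b ha hb => by simp [ha, hb, add_mul]) (fun c a ha => by simp [ha])
    (fun p => ?_) hu
  refine H1_induction (P := fun v => partialSum (tastH (word (indexWord p)) v) = _ * partialSum v)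
    (by simp) (fun a b ha hb => by simp [ha, hb, mul_add]) (fun c a ha => by simp [ha])
    (fun q => ?_) hv
  funext n
  rw [tastH_word, partialSum_tastIndex, Pi.mul_apply]

/-! ### The shuffle product and generating series -/

/-- The generating series of the coefficients. -/
def genSeries (u : H) : PowerSeries ℝ[X] := PowerSeries.mk (coef u)

theorem coeff_genSeries (u : H) (n : ℕ) : PowerSeries.coeff n (genSeries u) = coef u n :=
  PowerSeries.coeff_mk _ _

theorem genSeries_add (u v : H) : genSeries (u + v) = genSeries u + genSeries v := by
  ext1 n; simp [coeff_genSeries]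

theorem genSeries_sub (u v : H) : genSeries (u - v) = genSeries u - genSeries v := by
  ext1 n; simp [coeff_genSeries]

theorem genSeries_smul (c : ℚ[X]) (u : H) :
    genSeries (c • u) = PowerSeries.C (c.map (algebraMap ℚ ℝ)) * genSeries u := by
  ext1 n; simp [coeff_genSeries, ratPoly_smul_def]

theorem genSeries_zero : genSeries 0 = 0 := by
  ext1 n; simp [coeff_genSeries]

theorem genSeries_one : genSeries 1 = 1 := by
  ext1 n; rw [coeff_genSeries, coef_one, PowerSeries.coeff_one]

/-- The Euler derivation `X d/dX` of power series. -/
def euler (f : PowerSeries ℝ[X]) : PowerSeries ℝ[X] := PowerSeries.X * PowerSeries.derivative ℝ[X] f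

theorem coeff_euler (f : PowerSeries ℝ[X]) (n : ℕ) :
    PowerSeries.coeff n (euler f) = n * PowerSeries.coeff n f := by
  cases n with
  | zero => simp [euler]
  | succ n =>
    rw [euler, PowerSeries.coeff_succ_X_mul, PowerSeries.coeff_derivative]
    push_cast
    ring

theorem euler_mul (f g : PowerSeries ℝ[X]) : euler (f * g) = euler f * g + f * euler g := by
  simp only [euler, Derivation.leibniz, smul_eq_mul]
  ring

theorem euler_injective {f g : PowerSeries ℝ[X]} (h : euler f = euler g)
    (h0 : PowerSeries.coeff 0 f = PowerSeries.coeff 0 g) : f = g := by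
  ext1 n
  rcases Nat.eq_zero_or_pos n with rfl | hn
  · exact h0
  · have := congrArg (PowerSeries.coeff n) h
    rw [coeff_euler, coeff_euler] at this
    exact mul_left_cancel₀ (Nat.cast_ne_zero.mpr hn.ne') this

/-- The series `X + X² + X³ + ⋯`. -/
def geomSeries : PowerSeries ℝ[X] := PowerSeries.X * PowerSeries.mk 1

theorem coeff_geomSeries_mul (f : PowerSeries ℝ[X]) (n : ℕ) :
    PowerSeries.coeff n (geomSeries * f) = ∑ m ∈ Finset.range n, PowerSeries.coeff m f := by
  cases n with
  | zero => simp [geomSeries, mul_assoc]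
  | succ n =>
    rw [geomSeries, mul_assoc, PowerSeries.coeff_succ_X_mul, mul_comm, PowerSeries.coeff_mul,
      Finset.Nat.sum_antidiagonal_eq_sum_range_succ_mk]
    simp

/-- The factor by which the Euler derivation removes a letter from a word. -/
def letterFactor : Letter → PowerSeries ℝ[X]
  | Letter.x => 1
  | Letter.y => geomSeries

/-- The factor attached to `ρ`. -/
def rhoFactor : Letter → PowerSeries ℝ[X]
  | Letter.x => 0
  | Letter.y => PowerSeries.C X

theorem cast_mul_C_inv (n : ℕ) (p : ℝ[X]) (h : n = 0 → p = 0) :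
    (n : ℝ[X]) * (C ((n : ℝ)⁻¹) * p) = p := by
  rcases Nat.eq_zero_or_pos n with rfl | hn
  · simp [h rfl]
  · have : (n : ℝ[X]) = C (n : ℝ) := by simp
    rw [← mul_assoc, this, ← C_mul, mul_inv_cancel₀ (Nat.cast_ne_zero.mpr hn.ne'), C_1, one_mul]

theorem euler_genSeries_letter_mul (a : Letter) {u : H} (hu : u ∈ Hy) :
    euler (genSeries (letter a * u)) = (letterFactor a + rhoFactor a) * genSeries u := by
  ext1 n
  rw [coeff_euler, coeff_genSeries]
  cases a with
  | x =>
    simp only [letterFactor, rhoFactor, add_zero, one_mul]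
    rw [coef_x_mul, cast_mul_C_inv, coeff_genSeries]
    rintro rfl
    exact coef_zero_of_mem_Hy hu
  | y =>
    simp only [letterFactor, rhoFactor, add_mul, map_add]
    rw [coef_y_mul, cast_mul_C_inv, coeff_geomSeries_mul, PowerSeries.coeff_C_mul, coeff_genSeries]
    · simp only [coeff_genSeries, partialSum_apply]
    · rintro rfl
      rw [coef_zero_of_mem_Hy hu, partialSum_zero]; simp

theorem euler_genSeries_y : euler (genSeries (letter Letter.y)) = geomSeries := by
  ext1 n
  rw [coeff_euler, coeff_genSeries, ← mul_one (letter Letter.y), coef_y_mul,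
    ← mul_one geomSeries, coeff_geomSeries_mul, ← genSeries_one]
  simp only [coeff_genSeries, ← partialSum_apply]
  rcases Nat.eq_zero_or_pos n with rfl | hn
  · simp [partialSum_zero]
  · rw [coef_one, if_neg hn.ne', mul_zero, add_zero, cast_mul_C_inv _ _ (fun h => absurd h hn.ne')]

theorem euler_genSeries_rho_mul (a : Letter) {u : H} (hu : u ∈ Hy) :
    euler (genSeries (rho a * u)) = rhoFactor a * genSeries u := by
  cases a with
  | x => simp [rho, rhoFactor, genSeries_zero, euler]
  | y =>
    have h := euler_genSeries_letter_mul Letter.x hu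
    simp only [letterFactor, rhoFactor, add_zero, one_mul] at h
    rw [rho, smul_mul_assoc, genSeries_smul, euler_mul, h]
    have : euler (PowerSeries.C ((X : ℚ[X]).map (algebraMap ℚ ℝ))) = 0 := by
      ext1 n
      rw [coeff_euler, PowerSeries.coeff_C]
      split_ifs with hn <;> simp [hn]
    rw [this, rhoFactor]
    simp

/-- In front of the empty word the summand with `t` disappears, since `coef 1` lives at `n = 0`,
where the factor `n⁻¹` is `0`. This exception is what the `δ`-terms of the shuffle product account
for. -/
theorem euler_genSeries_word_cons (a : Letter) (w : List Letter)
    (hw : (a :: w).getLast? = some Letter.y) :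
    euler (genSeries (word (a :: w)))
      = (letterFactor a + PowerSeries.C ((1 - delta w).map (algebraMap ℚ ℝ)) * rhoFactor a)
          * genSeries (word w) := by
  rw [word_cons]
  cases w with
  | nil =>
    obtain rfl : a = Letter.y := by simpa using hw
    rw [word_nil, mul_one, euler_genSeries_y, genSeries_one]
    simp [delta, letterFactor]
  | cons b w =>
    rw [euler_genSeries_letter_mul a (word_mem_Hy (by simpa using hw))]
    simp [delta]

theorem euler_add (f g : PowerSeries ℝ[X]) : euler (f + g) = euler f + euler g := by
  simp [euler, mul_add]

theorem euler_sub (f g : PowerSeries ℝ[X]) : euler (f - g) = euler f - euler g := by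
  simp [euler, mul_sub]

theorem euler_C_mul (c : ℝ[X]) (f : PowerSeries ℝ[X]) :
    euler (PowerSeries.C c * f) = PowerSeries.C c * euler f := by
  ext1 n
  rw [coeff_euler, PowerSeries.coeff_C_mul, PowerSeries.coeff_C_mul, coeff_euler]
  ring

theorem tshuffleWord_nil_right (u : List Letter) : tshuffleWord u [] = word u := by
  cases u <;> simp [tshuffleWord]

theorem tshuffleWord_mem_Hy_left {u v : List Letter} (hu : u = [] ∨ u.getLast? = some Letter.y)
    (hv : v.getLast? = some Letter.y) : tshuffleWord u v ∈ Hy := by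
  rcases hu with rfl | hu
  · rw [tshuffleWord]; exact word_mem_Hy hv
  · exact tshuffleWord_mem_Hy u v hu hv

theorem tshuffleWord_mem_Hy_right {u v : List Letter} (hu : u.getLast? = some Letter.y)
    (hv : v = [] ∨ v.getLast? = some Letter.y) : tshuffleWord u v ∈ Hy := by
  rcases hv with rfl | hv
  · rw [tshuffleWord_nil_right]; exact word_mem_Hy hu
  · exact tshuffleWord_mem_Hy u v hu hv

theorem tail_ends_in_y {a : Letter} {u : List Letter} (hu : (a :: u).getLast? = some Letter.y) :
    u = [] ∨ u.getLast? = some Letter.y := by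
  cases u with
  | nil => exact Or.inl rfl
  | cons b u => exact Or.inr (by simpa using hu)

/-- Both sides have the same Euler derivative, by the Leibniz rule and induction, and the same
constant term. -/
theorem genSeries_tshuffleWord (u v : List Letter) (hu : u = [] ∨ u.getLast? = some Letter.y)
    (hv : v = [] ∨ v.getLast? = some Letter.y) :
    genSeries (tshuffleWord u v) = genSeries (word u) * genSeries (word v) := by
  match u, v with
  | [], v => rw [tshuffleWord, word_nil, genSeries_one, one_mul]
  | a :: u, [] => rw [tshuffleWord_nil_right, word_nil, genSeries_one, mul_one]
  | a :: u, b :: v =>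
    have hu' := hu.resolve_left (by simp)
    have hv' := hv.resolve_left (by simp)
    have h1 := genSeries_tshuffleWord u (b :: v) (tail_ends_in_y hu') hv
    have h2 := genSeries_tshuffleWord (a :: u) v hu (tail_ends_in_y hv')
    apply euler_injective
    · rw [euler_mul, euler_genSeries_word_cons a u hu', euler_genSeries_word_cons b v hv',
        tshuffleWord, genSeries_sub, genSeries_sub, genSeries_add, euler_sub, euler_sub, euler_add,
        genSeries_smul, genSeries_smul, euler_C_mul, euler_C_mul,
        euler_genSeries_rho_mul a (word_mem_Hy hv'), euler_genSeries_rho_mul b (word_mem_Hy hu'),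
        euler_genSeries_letter_mul a (tshuffleWord_mem_Hy_left (tail_ends_in_y hu') hv'),
        euler_genSeries_letter_mul b (tshuffleWord_mem_Hy_right hu' (tail_ends_in_y hv')), h1, h2]
      -- `δ(w)` is nonzero only for the empty word, whose series is `1`.
      have hd : ∀ w : List Letter, PowerSeries.C ((delta w).map (algebraMap ℚ ℝ))
            * genSeries (word w) = PowerSeries.C ((delta w).map (algebraMap ℚ ℝ)) := by
        intro w
        cases w
        · simp [word_nil, genSeries_one]
        · simp [delta]
      have e1 := hd u
      have e2 := hd v
      simp only [Polynomial.map_sub, Polynomial.map_one, map_sub, map_one]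
      linear_combination (rhoFactor a * genSeries (word (b :: v))) * e1
        + (rhoFactor b * genSeries (word (a :: u))) * e2
    · rw [PowerSeries.coeff_mul]
      simp [coeff_genSeries, coef_zero_of_mem_Hy (word_mem_Hy hu'),
        coef_zero_of_mem_Hy (tshuffleWord_mem_Hy _ _ hu' hv')]
  termination_by u.length + v.length

theorem genSeries_tshuffleH {u v : H} (hu : u ∈ H1) (hv : v ∈ H1) :
    genSeries (tshuffleH u v) = genSeries u * genSeries v := by
  refine H1_induction (P := fun u => genSeries (tshuffleH u v) = genSeries u * genSeries v)
    (by simp [genSeries_zero]) (fun a b ha hb => by simp [genSeries_add, ha, hb, add_mul])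
    (fun c a ha => by simp [genSeries_smul, ha, mul_assoc]) (fun p => ?_) hu
  refine H1_induction
    (P := fun v => genSeries (tshuffleH (word (indexWord p)) v) = _ * genSeries v)
    (by simp [genSeries_zero]) (fun a b ha hb => by simp [genSeries_add, ha, hb, mul_add])
    (fun c a ha => by simp only [map_smul, genSeries_smul, ha]; ring) (fun q => ?_) hv
  rw [tshuffleH_word, genSeries_tshuffleWord _ _ (getLast?_indexWord p) (getLast?_indexWord q)]

/-! ### Multiplication by `y` -/

theorem y_mul_mem_H1 {u : H} (hu : u ∈ H1) : letter Letter.y * u ∈ H1 := by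
  refine H1_induction (P := fun u => letter Letter.y * u ∈ H1)
    (by simp) (fun a b ha hb => by rw [mul_add]; exact H1.add_mem ha hb)
    (fun c a ha => by rw [mul_smul_comm]; exact H1.smul_mem c ha) (fun p => ?_) hu
  have : letter Letter.y * word (indexWord p) = word (indexWord (1 :: p)) := by
    rw [indexWord_cons, zWord_one]; rfl
  rw [this]
  exact word_indexWord_mem_H1 _

/-- The properties of the multiplication by `y` that make `𝔥_t¹` a module generated by `𝔥_t⁰`. -/
structure IsRaising (D : H →ₗ[ℚ[X]] H) : Prop where
  y_mul : ∀ u ∈ H1, D (letter Letter.y * u)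
    - letter Letter.y * (letter Letter.y * u) - letter Letter.y * D u ∈ H0
  of_H0 : ∀ u ∈ H0, D u - letter Letter.y * u ∈ H0

/-- The filtration of `𝔥_t¹` by the number of leading letters `y`. -/
def leadFiltration : ℕ → Submodule ℚ[X] H
  | 0 => H0
  | n + 1 => leadFiltration n ⊔ (leadFiltration n).map (LinearMap.mulLeft ℚ[X] (letter Letter.y))

theorem H0_le_leadFiltration (n : ℕ) : H0 ≤ leadFiltration n := by
  induction n with
  | zero => exact le_rfl
  | succ n ih => exact ih.trans le_sup_left

theorem leadFiltration_le_H1 (n : ℕ) : leadFiltration n ≤ H1 := by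
  induction n with
  | zero => exact H0_le_H1
  | succ n ih =>
    refine sup_le ih ?_
    rintro _ ⟨u, hu, rfl⟩
    exact y_mul_mem_H1 (ih hu)

theorem y_mul_mem_leadFiltration {n : ℕ} {u : H} (hu : u ∈ leadFiltration n) :
    letter Letter.y * u ∈ leadFiltration (n + 1) :=
  Submodule.mem_sup_right ⟨u, hu, rfl⟩

theorem exists_word_mem_leadFiltration (p : List ℕ+) :
    ∃ n, word (indexWord p) ∈ leadFiltration n := by
  induction p with
  | nil => exact ⟨0, one_mem_H0⟩
  | cons k p ih =>
    rcases eq_or_ne k 1 with rfl | hk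
    · obtain ⟨n, hn⟩ := ih
      refine ⟨n + 1, ?_⟩
      convert y_mul_mem_leadFiltration hn using 1
      rw [indexWord_cons, zWord_one]; rfl
    · obtain ⟨l, rfl⟩ := PNat.exists_eq_succ_of_ne_one hk
      refine ⟨0, ?_⟩
      rw [indexWord_cons, zWord_add_one, List.cons_append, ← indexWord_cons, word_cons]
      exact x_mul_mem_H0 (word_indexWord_mem_Hy l p)

/-- Moving `D` past a leading `y` costs one further left multiplication by `y`, modulo `H0`. So on
the `n`-th filtration step `D` is `n + 1` times that multiplication, up to lower terms. -/
theorem IsRaising.sub_mem {D : H →ₗ[ℚ[X]] H} (hD : IsRaising D) (n : ℕ) {u : H}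
    (hu : u ∈ leadFiltration n) :
    D u - (n + 1 : ℚ[X]) • (letter Letter.y * u) ∈ leadFiltration n := by
  induction n generalizing u with
  | zero =>
    change D u - ((0 : ℕ) + 1 : ℚ[X]) • (letter Letter.y * u) ∈ H0
    simpa using hD.of_H0 u hu
  | succ n ih =>
    obtain ⟨a, ha, _, ⟨b, hb, rfl⟩, rfl⟩ := Submodule.mem_sup.mp hu
    have h1 : D a - (n + 1 : ℚ[X]) • (letter Letter.y * a) ∈ leadFiltration (n + 1) :=
      Submodule.mem_sup_left (ih ha)
    have h2 := y_mul_mem_leadFiltration ha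
    have h3 := H0_le_leadFiltration (n + 1) (hD.y_mul b (leadFiltration_le_H1 n hb))
    have h4 := y_mul_mem_leadFiltration (ih hb)
    have := Submodule.add_mem _ (Submodule.sub_mem _ h1 h2) (Submodule.add_mem _ h3 h4)
    convert this using 1
    simp only [LinearMap.mulLeft_apply, map_add, mul_add, mul_sub, add_smul, one_smul, smul_add,
      mul_smul_comm, Nat.cast_add, Nat.cast_one]
    abel

/-- Generation of `H1` by `H0` and `D`, in the form needed for the existence of expansions as well
as for uniqueness of the regularizations. -/
theorem IsRaising.H1_le {D : H →ₗ[ℚ[X]] H} (hD : IsRaising D) (N : Submodule ℚ[X] H)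
    (h0 : H0 ≤ N) (hN : ∀ u ∈ H1, u ∈ N → D u ∈ N) : H1 ≤ N := by
  have key : ∀ n, leadFiltration n ≤ N := by
    intro n
    induction n with
    | zero => exact h0
    | succ n ih =>
      refine sup_le ih ?_
      rintro _ ⟨u, hu, rfl⟩
      have h1 := N.sub_mem (hN u (leadFiltration_le_H1 n hu) (ih hu)) (ih (hD.sub_mem n hu))
      -- Characteristic zero enters here: `(n + 1) • (y * u)` lies in `N`, so `y * u` does.
      have h2 := N.smul_mem (C ((n + 1 : ℚ)⁻¹)) h1
      convert h2 using 1
      have : (n + 1 : ℚ[X]) = C (n + 1 : ℚ) := by simp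
      rw [sub_sub_cancel, smul_smul, this, ← C_mul, inv_mul_cancel₀ (by positivity), C_1, one_smul]
      rfl
  intro u hu
  refine H1_induction (P := fun u => u ∈ N) N.zero_mem (fun _ _ => N.add_mem)
    (fun c _ => N.smul_mem c) (fun p => ?_) hu
  obtain ⟨n, hn⟩ := exists_word_mem_leadFiltration p
  exact key n hn

/-- After the terms that begin with `y` are removed, what remains of the recursion begins with `x`,
because `ρ(y) = t x`. -/
theorem isRaising_tshuffleH : IsRaising (tshuffleH (letter Letter.y)) := by
  have hy : letter Letter.y = word [Letter.y] := by simp [word]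
  have hx : letter Letter.x * letter Letter.y ∈ H0 :=
    x_mul_mem_H0 (by simpa using mul_y_mem_Hy 1)
  constructor
  · intro u hu
    refine H1_induction (P := fun u => tshuffleH (letter Letter.y) (letter Letter.y * u)
      - letter Letter.y * (letter Letter.y * u)
      - letter Letter.y * tshuffleH (letter Letter.y) u ∈ H0)
      (by simp) (fun a b ha hb => ?_) (fun c a ha => ?_) (fun p => ?_) hu
    · convert H0.add_mem ha hb using 1
      simp only [mul_add, map_add]; abel
    · convert H0.smul_mem c ha using 1
      simp only [mul_smul_comm, map_smul, smul_sub]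
    · rw [← word_cons, hy, tshuffleH_word, tshuffleH_word, tshuffleWord]
      have e : tshuffleWord [] (Letter.y :: indexWord p) = letter Letter.y * word (indexWord p) := by
        rw [tshuffleWord, word_cons]
      rw [e, ← hy]
      have h1 : rho Letter.y * word (Letter.y :: indexWord p) ∈ H0 := by
        rw [rho, smul_mul_assoc]
        refine H0.smul_mem _ (x_mul_mem_H0 (word_mem_Hy ?_))
        rcases getLast?_indexWord p with h | h
        · simp [h]
        · rw [List.getLast?_cons, h]; rfl
      have h2 : rho Letter.y * letter Letter.y ∈ H0 := by
        rw [rho, smul_mul_assoc]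
        exact H0.smul_mem _ hx
      have := H0.add_mem (H0.smul_mem (delta ([] : List Letter)) h1)
        (H0.smul_mem (delta (indexWord p)) h2)
      convert H0.neg_mem this using 1
      rw [word_cons]
      abel
  · intro u hu
    refine H0_induction (P := fun u => tshuffleH (letter Letter.y) u - letter Letter.y * u ∈ H0)
      (by simp) (fun a b ha hb => ?_) (fun c a ha => ?_) ?_ (fun k p => ?_) hu
    · convert H0.add_mem ha hb using 1
      simp only [mul_add, map_add]; abel
    · convert H0.smul_mem c ha using 1
      simp only [mul_smul_comm, map_smul, smul_sub]
    · rw [hy, ← word_nil, tshuffleH_word, tshuffleWord_nil_right, word_nil]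
      simp
    · have hz : indexWord ((k + 1) :: p) = Letter.x :: indexWord (k :: p) := by
        rw [indexWord_cons, zWord_add_one, List.cons_append, ← indexWord_cons]
      have hm : (indexWord (k :: p)).getLast? = some Letter.y := by
        refine (getLast?_indexWord (k :: p)).resolve_left ?_
        simp [indexWord_cons, zWord]
      rw [hz, hy, tshuffleH_word, tshuffleWord, ← hy]
      have h1 := x_mul_mem_H0 (tshuffleWord_mem_Hy [Letter.y] _ (by simp) hm)
      have h2 : rho Letter.y * word (Letter.x :: indexWord (k :: p)) ∈ H0 := by
        rw [rho, smul_mul_assoc]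
        refine H0.smul_mem _ (x_mul_mem_H0 ?_)
        rw [word_cons]
        exact mul_mem_Hy _ (word_mem_Hy hm)
      convert H0.sub_mem h1 (H0.smul_mem (delta ([] : List Letter)) h2) using 1
      rw [tshuffleWord, rho]
      simp only [zero_mul, smul_zero]
      abel

theorem isRaising_tastH : IsRaising (tastH (letter Letter.y)) := by
  have hy : letter Letter.y = word (indexWord [1]) := by simp [indexWord, zWord_one, word]
  have hz1 : z 1 = letter Letter.y := by simp [z, zWord_one, word]
  have hx : ∀ (k : ℕ+) (u : H), u ∈ H1 → z (k + 1) * u ∈ H0 := by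
    intro k u hu
    rw [z, zWord_add_one, word_cons, mul_assoc]
    refine x_mul_mem_H0 ?_
    refine H1_induction (P := fun u => word (zWord k) * u ∈ Hy) (by simp)
      (fun a b ha hb => by rw [mul_add]; exact Hy.add_mem ha hb)
      (fun c a ha => by rw [mul_smul_comm]; exact Hy.smul_mem c ha) (fun p => ?_) hu
    rw [← word_append, ← indexWord_cons]
    exact word_indexWord_mem_Hy k p
  -- The factor `1 - δ` is essential: a bare power of `x` does not lie in `H0`.
  have hx' : ∀ (k : ℕ+) (p : List ℕ+), (1 - delta p) • (letter Letter.x ^ (k : ℕ)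
      * word (indexWord p)) ∈ H0 := by
    intro k p
    cases p with
    | nil => simp [delta]
    | cons l p =>
      refine H0.smul_mem _ ?_
      rw [← Nat.sub_add_cancel k.pos, pow_succ', mul_assoc]
      exact x_mul_mem_H0 (mul_mem_Hy _ (word_indexWord_mem_Hy l p))
  -- The merged terms of `z 1 * z l` begin with `z (1 + l)` or `x ^ (1 + l)`, hence with `x`.
  have hstep : ∀ (l : ℕ+) (p : List ℕ+),
      tastH (letter Letter.y) (word (indexWord (l :: p))) - letter Letter.y
        * word (indexWord (l :: p)) - z l * tastH (letter Letter.y) (word (indexWord p)) ∈ H0 := by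
    intro l p
    rw [hy, tastH_word, tastH_word, tastIndex, ← hy, hz1, tastIndex, tastIndex]
    have h1 := hx l _ (word_indexWord_mem_H1 p)
    have h2 := hx' (1 + l) p
    rw [add_comm l 1] at h1
    convert H0.add_mem (H0.smul_mem (1 - 2 * X : ℚ[X]) h1)
      (H0.smul_mem (X ^ 2 - X : ℚ[X]) h2) using 1
    rw [smul_smul]
    simp only [delta, one_mul]
    rw [mul_comm (X ^ 2 - X : ℚ[X])]
    abel
  constructor
  · intro u hu
    refine H1_induction (P := fun u => tastH (letter Letter.y) (letter Letter.y * u)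
      - letter Letter.y * (letter Letter.y * u)
      - letter Letter.y * tastH (letter Letter.y) u ∈ H0)
      (by simp) (fun a b ha hb => ?_) (fun c a ha => ?_) (fun p => ?_) hu
    · convert H0.add_mem ha hb using 1
      simp only [mul_add, map_add]; abel
    · convert H0.smul_mem c ha using 1
      simp only [mul_smul_comm, map_smul, smul_sub]
    · have := hstep 1 p
      rwa [word_indexWord_cons, hz1] at this
  · intro u hu
    refine H0_induction (P := fun u => tastH (letter Letter.y) u - letter Letter.y * u ∈ H0)
      (by simp) (fun a b ha hb => ?_) (fun c a ha => ?_) ?_ (fun k p => ?_) hu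
    · convert H0.add_mem ha hb using 1
      simp only [mul_add, map_add]; abel
    · convert H0.smul_mem c ha using 1
      simp only [mul_smul_comm, map_smul, smul_sub]
    · have : (1 : H) = word (indexWord []) := rfl
      rw [this, hy, tastH_word, tastIndex]
      · simp [indexWord, word_nil]
      · simp
    · have h1 := hstep (k + 1) p
      have h2 := hx k _ (tastH_mem (letter Letter.y) (word (indexWord p)))
      convert H0.add_mem h1 h2 using 1
      abel

open Filter Topology

/-! ### Polynomial expansions of sequences -/

/-- `e` tends to zero faster than every power of `1 / Λ`. -/
def RapidlyVanishes (Λ e : ℕ → ℝ) : Prop :=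
  ∀ j : ℕ, Tendsto (fun n => e n * Λ n ^ j) atTop (𝓝 0)

/-- The family `f` of sequences is, up to a rapidly vanishing error, the polynomial `P` in `Λ`. -/
def HasExpansion (Λ : ℕ → ℝ) (f : ℝ → ℕ → ℝ) (P : RtT) : Prop :=
  ∀ τ, RapidlyVanishes Λ fun n => f τ n - (P.map (evalRingHom τ)).eval (Λ n)

section

variable {Λ e e' : ℕ → ℝ} {f g : ℝ → ℕ → ℝ} {P Q : RtT}

theorem RapidlyVanishes.tendsto (h : RapidlyVanishes Λ e) : Tendsto e atTop (𝓝 0) := by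
  simpa using h 0

theorem RapidlyVanishes.add (h : RapidlyVanishes Λ e) (h' : RapidlyVanishes Λ e') :
    RapidlyVanishes Λ (e + e') := by
  intro j
  simpa [add_mul] using (h j).add (h' j)

theorem RapidlyVanishes.mul (h : RapidlyVanishes Λ e) (h' : RapidlyVanishes Λ e') :
    RapidlyVanishes Λ (e * e') := by
  intro j
  simpa [mul_assoc] using h.tendsto.mul (h' j)

/-- This is why decay against every power of `Λ` is required: expansions can then be multiplied. -/
theorem RapidlyVanishes.mul_eval (h : RapidlyVanishes Λ e) (p : ℝ[X]) :
    RapidlyVanishes Λ fun n => e n * p.eval (Λ n) := by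
  induction p using Polynomial.induction_on' with
  | add p q hp hq => simpa [mul_add, Pi.add_def] using hp.add hq
  | monomial k a =>
    intro j
    have := (h (k + j)).const_mul a
    rw [mul_zero] at this
    refine this.congr fun n => ?_
    simp only [eval_monomial]
    ring

theorem HasExpansion.add (hf : HasExpansion Λ f P) (hg : HasExpansion Λ g Q) :
    HasExpansion Λ (f + g) (P + Q) := by
  intro τ
  convert (hf τ).add (hg τ) using 1
  funext n
  simp only [Pi.add_apply, Polynomial.map_add, eval_add]
  ring

theorem HasExpansion.mul (hf : HasExpansion Λ f P) (hg : HasExpansion Λ g Q) :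
    HasExpansion Λ (f * g) (P * Q) := by
  intro τ
  convert (((hf τ).mul (hg τ)).add ((hf τ).mul_eval (Q.map (evalRingHom τ)))).add
    ((hg τ).mul_eval (P.map (evalRingHom τ))) using 1
  funext n
  simp only [Pi.add_apply, Pi.mul_apply, Polynomial.map_mul, eval_mul]
  ring

theorem HasExpansion.of_eq (h : ∀ τ n, f τ n = (P.map (evalRingHom τ)).eval (Λ n)) :
    HasExpansion Λ f P := by
  intro τ j
  simp [h]

theorem eq_zero_of_tendsto_eval (hΛ : Tendsto Λ atTop atTop) {p : ℝ[X]}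
    (hp : Tendsto (fun n => p.eval (Λ n)) atTop (𝓝 0)) : p = 0 := by
  rcases le_or_gt p.degree 0 with h | h
  · rw [eq_C_of_degree_le_zero h] at hp ⊢
    simp only [eval_C] at hp
    rw [tendsto_nhds_unique tendsto_const_nhds hp, C_0]
  · have h1 := (Polynomial.abs_tendsto_atTop p h).comp hΛ
    exact absurd hp.abs (not_tendsto_nhds_of_tendsto_atTop h1 _)

/-- All asymptotics are taken at a fixed real value `τ` of `t`; identities in `ℝ[t, T]` are
recovered from all values. -/
theorem eq_zero_of_map_evalRingHom (h : ∀ τ : ℝ, P.map (evalRingHom τ) = 0) : P = 0 := by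
  ext1 k
  refine Polynomial.funext fun τ => ?_
  have := congrArg (fun p => p.coeff k) (h τ)
  simpa using this

theorem eq_zero_of_tendsto_map_eval (hΛ : Tendsto Λ atTop atTop)
    (h : ∀ τ, Tendsto (fun n => (P.map (evalRingHom τ)).eval (Λ n)) atTop (𝓝 0)) : P = 0 :=
  eq_zero_of_map_evalRingHom fun τ => eq_zero_of_tendsto_eval hΛ (h τ)

theorem HasExpansion.unique (hΛ : Tendsto Λ atTop atTop) (hP : HasExpansion Λ f P)
    (hQ : HasExpansion Λ f Q) : P = Q := by
  rw [← sub_eq_zero]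
  refine eq_zero_of_tendsto_map_eval hΛ fun τ => ?_
  have := (hQ τ).tendsto.sub (hP τ).tendsto
  rw [sub_zero] at this
  refine this.congr fun n => ?_
  simp

end

/-! ### Regularization -/

theorem ratPoly_smul_RtT (c : ℚ[X]) (P : RtT) : c • P = C (c.map (algebraMap ℚ ℝ)) * P := by
  rw [Algebra.smul_def, Polynomial.algebraMap_apply]
  rfl

/-- A realization of the product `mul` on `𝔥_t¹` by sequences which depend on the value of `t`. -/
structure IsRealization (mul : H →ₗ[ℚ[X]] H →ₗ[ℚ[X]] H) (Λ : ℕ → ℝ) (Φ : H → ℝ → ℕ → ℝ) :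
    Prop where
  tendsto : Tendsto Λ atTop atTop
  map_add : ∀ u v, Φ (u + v) = Φ u + Φ v
  map_smul : ∀ (c : ℚ[X]) u τ n, Φ (c • u) τ n = (c.map (algebraMap ℚ ℝ)).eval τ * Φ u τ n
  map_mul : ∀ u ∈ H1, ∀ v ∈ H1, Φ (mul u v) = Φ u * Φ v
  map_y : ∀ τ, Φ (letter Letter.y) τ = Λ
  of_H0 : ∀ u : H0, HasExpansion Λ (Φ u) (C (Zt u))

theorem Zt_one : Zt ⟨1, one_mem_H0⟩ = 1 := by
  refine (Zt_word [] one_mem_H0).trans ?_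
  have : zeta [] = 1 := by
    have huniq : ∀ m : {m : Fin ([] : List ℕ+).length → ℕ+ // StrictAnti m},
        m = ⟨fun i => i.elim0, fun i => i.elim0⟩ := by
      rintro ⟨m, hm⟩
      congr 1
      funext i
      exact i.elim0
    rw [zeta, tsum_eq_single ⟨fun i => i.elim0, fun i => i.elim0⟩
      (fun m hm => absurd (huniq m) hm)]
    exact Finset.prod_eq_one fun i _ => i.elim0
  simp [zetaT, fillings, this]

/-- The elements with an expansion form a submodule that contains `H0` and is stable under the
product with `y`, hence contains `H1`. Since expansions are unique, every algebraic identity of `Φ`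
passes to `Z`. -/
theorem IsRealization.exists_regularization {mul : H →ₗ[ℚ[X]] H →ₗ[ℚ[X]] H} {Λ : ℕ → ℝ}
    {Φ : H → ℝ → ℕ → ℝ} (h : IsRealization mul Λ Φ) (hD : IsRaising (mul (letter Letter.y)))
    {mul' : H1 → H1 → H1} (hmul : ∀ u v : H1, (mul' u v : H) = mul u v) :
    ∃ Z : H1 →ₗ[ℚ[X]] RtT, IsRegularization mul' Z ∧ ∀ u : H1, HasExpansion Λ (Φ u) (Z u) := by
  have hy : HasExpansion Λ (Φ (letter Letter.y)) X :=
    HasExpansion.of_eq fun τ n => by simp [h.map_y]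
  have hsmul : ∀ (c : ℚ[X]) u P, HasExpansion Λ (Φ u) P → HasExpansion Λ (Φ (c • u)) (c • P) := by
    intro c u P hP
    have hc : HasExpansion Λ (fun τ _ => (c.map (algebraMap ℚ ℝ)).eval τ)
        (C (c.map (algebraMap ℚ ℝ))) := HasExpansion.of_eq fun τ n => by simp
    rw [ratPoly_smul_RtT]
    convert hc.mul hP using 1
    funext τ n
    exact h.map_smul c u τ n
  have hadd : ∀ u v P Q, HasExpansion Λ (Φ u) P → HasExpansion Λ (Φ v) Q →
      HasExpansion Λ (Φ (u + v)) (P + Q) := by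
    intro u v P Q hP hQ
    rw [h.map_add]
    exact hP.add hQ
  let N : Submodule ℚ[X] H :=
    { carrier := {u | ∃ P, HasExpansion Λ (Φ u) P}
      zero_mem' := ⟨_, h.of_H0 0⟩
      add_mem' := fun ⟨P, hP⟩ ⟨Q, hQ⟩ => ⟨P + Q, hadd _ _ _ _ hP hQ⟩
      smul_mem' := fun c _ ⟨P, hP⟩ => ⟨c • P, hsmul c _ _ hP⟩ }
  have hN : H1 ≤ N := by
    refine hD.H1_le N (fun u hu => ⟨_, h.of_H0 ⟨u, hu⟩⟩) ?_
    rintro u hu ⟨P, hP⟩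
    refine ⟨X * P, ?_⟩
    rw [h.map_mul (letter Letter.y) yH1.2 _ hu]
    exact hy.mul hP
  choose Z hZ using fun u : H1 => hN u.2
  have uniq : ∀ (u : H1) P, HasExpansion Λ (Φ u) P → Z u = P :=
    fun u P hP => (hZ u).unique h.tendsto hP
  let L : H1 →ₗ[ℚ[X]] RtT :=
    { toFun := Z
      map_add' := fun u v => uniq (u + v) _ (hadd _ _ _ _ (hZ u) (hZ v))
      map_smul' := fun c u => uniq (c • u) _ (hsmul c _ _ (hZ u)) }
  have h1 : Z ⟨1, one_mem_H1⟩ = 1 := by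
    refine (uniq ⟨1, one_mem_H1⟩ _ (h.of_H0 ⟨1, one_mem_H0⟩)).trans ?_
    rw [Zt_one, C_1]
  have h2 : ∀ u v : H1, Z (mul' u v) = Z u * Z v := by
    intro u v
    refine uniq (mul' u v) _ ?_
    rw [hmul, h.map_mul _ u.2 _ v.2]
    exact (hZ u).mul (hZ v)
  have h3 : ∀ u : H0, Z (toH1 u) = C (Zt u) := fun u => uniq (toH1 u) _ (h.of_H0 u)
  have h4 : Z yH1 = X := uniq yH1 _ hy
  exact ⟨L, ⟨h1, h2, h3, h4⟩, hZ⟩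

/-- The locus where two regularizations agree contains `H0` and is stable under the product with
`y`. -/
theorem IsRegularization.unique {mul : H →ₗ[ℚ[X]] H →ₗ[ℚ[X]] H}
    (hD : IsRaising (mul (letter Letter.y)))
    {mul' : H1 → H1 → H1} (hmul : ∀ u v : H1, (mul' u v : H) = mul u v)
    {Z Z' : H1 →ₗ[ℚ[X]] RtT} (hZ : IsRegularization mul' Z) (hZ' : IsRegularization mul' Z') :
    Z = Z' := by
  have key : H1 ≤ (LinearMap.eqLocus Z Z').map H1.subtype := by
    refine hD.H1_le _ (fun u hu => ⟨toH1 ⟨u, hu⟩, ?_, rfl⟩) ?_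
    · exact (hZ.restrict _).trans (hZ'.restrict _).symm
    · rintro _ _ ⟨u, hu, rfl⟩
      refine ⟨mul' yH1 u, ?_, hmul yH1 u⟩
      have hu' : Z u = Z' u := hu
      change Z _ = Z' _
      rw [hZ.map_mul, hZ'.map_mul, hZ.map_y, hZ'.map_y, hu']
  ext1 u
  obtain ⟨v, hv, hvu⟩ := key u.2
  obtain rfl : v = u := Subtype.ext hvu
  exact hv

/-! ### Growth of the coefficients -/

/-- The harmonic sum `∑_{0 < m < n} 1 / m`. -/
def harmonicSum (n : ℕ) : ℝ := ∑ m ∈ Finset.range n, (m : ℝ)⁻¹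

theorem harmonicSum_nonneg (n : ℕ) : 0 ≤ harmonicSum n :=
  Finset.sum_nonneg fun _ _ => by positivity

theorem one_le_one_add_harmonicSum (n : ℕ) : 1 ≤ 1 + harmonicSum n := by
  linarith [harmonicSum_nonneg n]

theorem harmonicSum_mono : Monotone harmonicSum := fun m n h =>
  Finset.sum_le_sum_of_subset_of_nonneg (Finset.range_mono h) fun _ _ _ => by positivity

theorem harmonicSum_succ_eq (n : ℕ) :
    harmonicSum (n + 1) = ∑ i ∈ Finset.range n, 1 / ((i : ℝ) + 1) := by
  rw [harmonicSum, Finset.sum_range_succ']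
  simp

theorem tendsto_harmonicSum : Tendsto harmonicSum atTop atTop := by
  rw [← tendsto_add_atTop_iff_nat 1]
  simpa only [harmonicSum_succ_eq] using Real.tendsto_sum_range_one_div_nat_succ_atTop

theorem harmonicSum_le (n : ℕ) : harmonicSum n ≤ 1 + Real.log n := by
  refine (harmonicSum_mono n.le_succ).trans ?_
  have := harmonic_le_one_add_log n
  rw [harmonicSum_succ_eq]
  simpa [harmonic] using this

theorem exists_pow_le_rpow (r : ℕ) :
    ∃ K : ℝ, ∀ n : ℕ, 1 ≤ n → (1 + harmonicSum n) ^ r ≤ K * (n : ℝ) ^ (1 / 4 : ℝ) := by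
  -- Chosen so that `ε * r ≤ 1 / 4`, with `log n ≤ n ^ ε / ε`.
  set ε : ℝ := 1 / (4 * (r + 1)) with hε
  have hε0 : 0 < ε := by positivity
  refine ⟨(2 + 1 / ε) ^ r, fun n hn => ?_⟩
  have hn' : (1 : ℝ) ≤ n := by exact_mod_cast hn
  have h1 : (1 : ℝ) ≤ (n : ℝ) ^ ε := Real.one_le_rpow hn' hε0.le
  have h2 := Real.log_le_rpow_div (x := (n : ℝ)) (by positivity) hε0
  have h3 : 1 + harmonicSum n ≤ (2 + 1 / ε) * (n : ℝ) ^ ε := by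
    have := harmonicSum_le n
    rw [div_eq_mul_one_div] at h2
    nlinarith
  refine (pow_le_pow_left₀ (by linarith [harmonicSum_nonneg n]) h3 r).trans ?_
  rw [mul_pow]
  refine mul_le_mul_of_nonneg_left ?_ (by positivity)
  rw [← Real.rpow_natCast, ← Real.rpow_mul (by positivity)]
  refine Real.rpow_le_rpow_of_exponent_le hn' ?_
  rw [hε, div_mul_eq_mul_div, div_le_div_iff₀ (by positivity) (by norm_num)]
  linarith

theorem eval_partialSum (τ : ℝ) (u : H) (n : ℕ) :
    (partialSum u n).eval τ = ∑ m ∈ Finset.range n, (coef u m).eval τ := by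
  rw [partialSum_apply, eval_finsetSum]

theorem eval_coef_x_mul (τ : ℝ) (u : H) (n : ℕ) :
    (coef (letter Letter.x * u) n).eval τ = (n : ℝ)⁻¹ * (coef u n).eval τ := by
  rw [coef_x_mul, eval_mul, eval_C]

theorem eval_coef_y_mul (τ : ℝ) (u : H) (n : ℕ) : (coef (letter Letter.y * u) n).eval τ
    = (n : ℝ)⁻¹ * ((partialSum u n).eval τ + τ * (coef u n).eval τ) := by
  rw [coef_y_mul, eval_mul, eval_C, eval_add, eval_mul, eval_X]

/-- Each letter costs at most one factor `1 + harmonicSum n`, by summing the bound `1 / m` for `m <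
n`. -/
theorem exists_bound_word (τ : ℝ) (w : List Letter) :
    ∃ K : ℝ, 0 ≤ K ∧ ∀ n : ℕ,
      |(partialSum (word w) n).eval τ| ≤ K * (1 + harmonicSum n) ^ w.length ∧
      n * |(coef (word w) n).eval τ| ≤ K * (1 + harmonicSum n) ^ w.length := by
  induction w with
  | nil =>
    refine ⟨1, zero_le_one, fun n => ?_⟩
    rw [word_nil, partialSum_one, coef_one]
    rcases Nat.eq_zero_or_pos n with rfl | hn
    · simp
    · simp [hn.ne']
  | cons a w ih =>
    obtain ⟨K, hK, h⟩ := ih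
    have h1 : ∀ n : ℕ, |(coef (word (a :: w)) n).eval τ|
        ≤ (n : ℝ)⁻¹ * (K * (1 + |τ|) * (1 + harmonicSum n) ^ w.length) := by
      intro n
      rcases Nat.eq_zero_or_pos n with rfl | hn
      · cases a
        · rw [word_cons, eval_coef_x_mul]; simp
        · rw [word_cons, eval_coef_y_mul]; simp
      · have h2 : |(coef (word w) n).eval τ| ≤ K * (1 + harmonicSum n) ^ w.length := by
          refine le_trans ?_ (h n).2
          have : (1 : ℝ) ≤ n := by exact_mod_cast hn
          nlinarith [abs_nonneg ((coef (word w) n).eval τ)]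
        have h3 := (h n).1
        have h4 := abs_nonneg τ
        cases a
        · rw [word_cons, eval_coef_x_mul, abs_mul, abs_of_nonneg (by positivity : 0 ≤ (n : ℝ)⁻¹)]
          refine mul_le_mul_of_nonneg_left ?_ (by positivity)
          nlinarith [abs_nonneg ((coef (word w) n).eval τ)]
        · rw [word_cons, eval_coef_y_mul, abs_mul, abs_of_nonneg (by positivity : 0 ≤ (n : ℝ)⁻¹)]
          refine mul_le_mul_of_nonneg_left ?_ (by positivity)
          refine (abs_add_le _ _).trans ?_
          rw [abs_mul]
          nlinarith
    refine ⟨K * (1 + |τ|), by positivity, fun n => ?_⟩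
    rw [List.length_cons, pow_succ, ← mul_assoc]
    have h0 := harmonicSum_nonneg
    constructor
    · rw [eval_partialSum]
      refine (Finset.abs_sum_le_sum_abs _ _).trans ?_
      have : ∀ m ∈ Finset.range n, |(coef (word (a :: w)) m).eval τ|
          ≤ (K * (1 + |τ|) * (1 + harmonicSum n) ^ w.length) * (m : ℝ)⁻¹ := by
        intro m hm
        refine (h1 m).trans ?_
        rw [mul_comm]
        have := h0 m
        have := harmonicSum_mono (Finset.mem_range.mp hm).le
        gcongr
      refine (Finset.sum_le_sum this).trans ?_
      rw [← Finset.mul_sum]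
      have := h0 n
      refine mul_le_mul_of_nonneg_left ?_ (by positivity)
      change harmonicSum n ≤ _
      linarith
    · have h2 := mul_le_mul_of_nonneg_left (h1 n) (Nat.cast_nonneg (α := ℝ) n)
      refine h2.trans ?_
      have h3 : (n : ℝ) * (n : ℝ)⁻¹ ≤ 1 + harmonicSum n :=
        mul_inv_le_one.trans (one_le_one_add_harmonicSum n)
      have := h0 n
      rw [← mul_assoc, mul_comm]
      exact mul_le_mul_of_nonneg_left h3 (by positivity)

/-- A leading `x` gains a second factor `1 / n` over `exists_bound_word`. -/
theorem exists_bound_of_mem_H0 (τ : ℝ) {u : H} (hu : u ∈ H0) :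
    ∃ (K : ℝ) (r : ℕ), 0 ≤ K ∧
      ∀ n : ℕ, (n : ℝ) ^ 2 * |(coef u n).eval τ| ≤ K * (1 + harmonicSum n) ^ r := by
  refine H0_induction (P := fun u => ∃ (K : ℝ) (r : ℕ), 0 ≤ K ∧
      ∀ n : ℕ, (n : ℝ) ^ 2 * |(coef u n).eval τ| ≤ K * (1 + harmonicSum n) ^ r)
    ⟨0, 0, le_rfl, by simp⟩ ?_ ?_ ⟨0, 0, le_rfl, fun n => ?_⟩ (fun k p => ?_) hu
  · rintro u v ⟨K, r, hK, h⟩ ⟨K', r', hK', h'⟩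
    refine ⟨K + K', max r r', by positivity, fun n => ?_⟩
    have h1 := pow_le_pow_right₀ (one_le_one_add_harmonicSum n) (le_max_left r r')
    have h2 := pow_le_pow_right₀ (one_le_one_add_harmonicSum n) (le_max_right r r')
    have h3 := mul_le_mul_of_nonneg_left h1 hK
    have h4 := mul_le_mul_of_nonneg_left h2 hK'
    have h5 := mul_le_mul_of_nonneg_left
      (abs_add_le ((coef u n).eval τ) ((coef v n).eval τ)) (sq_nonneg (n : ℝ))
    rw [map_add, Pi.add_apply, eval_add]
    linarith [h n, h' n]
  · rintro c u ⟨K, r, hK, h⟩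
    refine ⟨|(c.map (algebraMap ℚ ℝ)).eval τ| * K, r, by positivity, fun n => ?_⟩
    rw [map_smul, Pi.smul_apply, ratPoly_smul_def, eval_mul, abs_mul, mul_left_comm, mul_assoc]
    exact mul_le_mul_of_nonneg_left (h n) (abs_nonneg _)
  · rw [coef_one]
    rcases Nat.eq_zero_or_pos n with rfl | hn
    · simp
    · simp [hn.ne']
  · obtain ⟨K, hK, h⟩ := exists_bound_word τ (indexWord (k :: p))
    refine ⟨K, _, hK, fun n => le_trans (le_of_eq ?_) (h n).2⟩
    rw [indexWord_cons, zWord_add_one, List.cons_append, ← indexWord_cons, word_cons,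
      eval_coef_x_mul, abs_mul, abs_of_nonneg (by positivity : 0 ≤ (n : ℝ)⁻¹)]
    rcases Nat.eq_zero_or_pos n with rfl | hn
    · simp
    · have : (n : ℝ) ≠ 0 := Nat.cast_ne_zero.mpr hn.ne'
      field_simp

theorem exists_rpow_bound_of_mem_H0 (τ : ℝ) {u : H} (hu : u ∈ H0) (j : ℕ) :
    ∃ K : ℝ, ∀ n : ℕ, 1 ≤ n →
      |(coef u n).eval τ| * (1 + harmonicSum n) ^ j ≤ K * (n : ℝ) ^ (-(7 / 4) : ℝ) := by
  obtain ⟨K, r, hK, h⟩ := exists_bound_of_mem_H0 τ hu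
  obtain ⟨K', h'⟩ := exists_pow_le_rpow (r + j)
  refine ⟨K * K', fun n hn => ?_⟩
  have hn' : (0 : ℝ) < n := by exact_mod_cast hn
  have h0 := harmonicSum_nonneg n
  have h1 := mul_le_mul_of_nonneg_right (h n) (by positivity : 0 ≤ (1 + harmonicSum n) ^ j)
  rw [mul_assoc K, ← pow_add] at h1
  have h2 := h1.trans (mul_le_mul_of_nonneg_left (h' n hn) hK)
  have h3 : (n : ℝ) ^ (1 / 4 : ℝ) = (n : ℝ) ^ 2 * (n : ℝ) ^ (-(7 / 4) : ℝ) := by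
    rw [← Real.rpow_natCast, ← Real.rpow_add hn']
    norm_num
  rw [h3] at h2
  refine le_of_mul_le_mul_left ?_ (by positivity : 0 < (n : ℝ) ^ 2)
  linarith

theorem summable_coef_mul_pow (τ : ℝ) {u : H} (hu : u ∈ H0) (j : ℕ) :
    Summable fun n => |(coef u n).eval τ| * (1 + harmonicSum n) ^ j := by
  obtain ⟨K, h⟩ := exists_rpow_bound_of_mem_H0 τ hu j
  refine Summable.of_norm_bounded_eventually_nat (g := fun n => K * (n : ℝ) ^ (-(7 / 4) : ℝ))
    ((Real.summable_nat_rpow.mpr (by norm_num)).mul_left K) ?_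
  filter_upwards [eventually_ge_atTop 1] with n hn
  have h0 := harmonicSum_nonneg n
  rw [Real.norm_of_nonneg (by positivity)]
  exact h n hn

/-- The weight `n ^ (1 / 4)` is the one that appears in `one_sub_pow_le`; the exponent `-7/4 + 1/4 =
-3/2` still gives convergence. -/
theorem summable_coef_mul_rpow (τ : ℝ) {u : H} (hu : u ∈ H0) :
    Summable fun n : ℕ => |(coef u n).eval τ| * (n : ℝ) ^ (1 / 4 : ℝ) := by
  obtain ⟨K, h⟩ := exists_rpow_bound_of_mem_H0 τ hu 0
  refine Summable.of_norm_bounded_eventually_nat (g := fun n => K * (n : ℝ) ^ (-(3 / 2) : ℝ))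
    ((Real.summable_nat_rpow.mpr (by norm_num)).mul_left K) ?_
  filter_upwards [eventually_ge_atTop 1] with n hn
  have hn' : (0 : ℝ) < n := by exact_mod_cast hn
  rw [Real.norm_of_nonneg (by positivity)]
  have h1 := h n hn
  rw [pow_zero, mul_one] at h1
  refine (mul_le_mul_of_nonneg_right h1 (by positivity)).trans (le_of_eq ?_)
  rw [mul_assoc, ← Real.rpow_add hn']
  norm_num

theorem summable_coef (τ : ℝ) {u : H} (hu : u ∈ H0) :
    Summable fun n => (coef u n).eval τ := by
  have := summable_coef_mul_pow τ hu 0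
  simp only [pow_zero, mul_one] at this
  exact this.of_abs

/-! ### Multiple zeta values as sums of coefficients -/

theorem eval_zero_coefWord_nonneg (w : List Letter) (n : ℕ) : 0 ≤ (coefWord w n).eval 0 := by
  induction w generalizing n with
  | nil => rw [coefWord]; split_ifs <;> simp
  | cons a w ih =>
    cases a
    · rw [coefWord, eval_mul, eval_C]
      exact mul_nonneg (by positivity) (ih n)
    · rw [coefWord, eval_mul, eval_C, eval_add, eval_mul, eval_X, zero_mul, add_zero,
        eval_finsetSum]
      exact mul_nonneg (by positivity) (Finset.sum_nonneg fun m _ => ih m)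

theorem eval_zero_coef_cons (k : ℕ+) (p : List ℕ+) (n : ℕ) :
    (coef (word (indexWord (k :: p))) n).eval 0
      = 1 / (n : ℝ) ^ (k : ℕ) * (partialSum (word (indexWord p)) n).eval 0 := by
  rw [word_indexWord_cons, coef_z_mul]
  simp

theorem strictAnti_cons {r : ℕ} (a : ℕ+) (m : Fin r → ℕ+) :
    StrictAnti (Fin.cons a m : Fin (r + 1) → ℕ+) ↔ StrictAnti m ∧ ∀ i, m i < a := by
  constructor
  · intro h
    refine ⟨fun i j hij => ?_, fun i => ?_⟩
    · simpa using h (Fin.succ_lt_succ_iff.mpr hij)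
    · simpa using h (Fin.succ_pos i)
  · rintro ⟨h, h'⟩ i j hij
    induction j using Fin.cases with
    | zero => simp at hij
    | succ j =>
      induction i using Fin.cases with
      | zero => simpa using h' j
      | succ i => simpa using h (Fin.succ_lt_succ_iff.mp hij)

/-- The largest summation variable is split off, in `ENNReal` so that no summability is needed. The
predicate `S` covers both the truncated sums (`a < n`) and the full series (`True`). -/
theorem tsum_strictAnti_cons (k : ℕ+) (p : List ℕ+) (S : ℕ+ → Prop) :
    ∑' m, Set.indicator {m : Fin (k :: p).length → ℕ+ | StrictAnti m ∧ ∀ i, S (m i)} (fun m =>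
        ∏ i, ENNReal.ofReal (1 / ((m i : ℕ) : ℝ) ^ (((k :: p).get i : ℕ+) : ℕ))) m
      = ∑' a : ℕ+, ENNReal.ofReal (1 / ((a : ℕ) : ℝ) ^ (k : ℕ))
        * ∑' m, Set.indicator
          {m : Fin p.length → ℕ+ | S a ∧ StrictAnti m ∧ ∀ i, m i < a ∧ S (m i)} (fun m =>
            ∏ i, ENNReal.ofReal (1 / ((m i : ℕ) : ℝ) ^ ((p.get i : ℕ+) : ℕ))) m := by
  refine ((Fin.consEquiv (n := p.length) fun _ => ℕ+).tsum_eq _).symm.trans ?_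
  rw [ENNReal.tsum_prod']
  refine tsum_congr fun a => ?_
  rw [← ENNReal.tsum_mul_left]
  refine tsum_congr fun m => ?_
  have h : (Fin.cons a m : Fin (p.length + 1) → ℕ+) ∈
        {m : Fin (k :: p).length → ℕ+ | StrictAnti m ∧ ∀ i, S (m i)} ↔
      m ∈ {m : Fin p.length → ℕ+ | S a ∧ StrictAnti m ∧ ∀ i, m i < a ∧ S (m i)} := by
    change StrictAnti (Fin.cons a m : Fin (p.length + 1) → ℕ+) ∧
      (∀ i, S ((Fin.cons a m : Fin (p.length + 1) → ℕ+) i)) ↔ _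
    rw [strictAnti_cons, Fin.forall_fin_succ]
    simp only [Fin.cons_zero, Fin.cons_succ, forall_and, Set.mem_ofPred_eq]
    tauto
  change Set.indicator _ _ (Fin.cons a m : Fin (p.length + 1) → ℕ+) = _
  by_cases hm : m ∈ {m : Fin p.length → ℕ+ | S a ∧ StrictAnti m ∧ ∀ i, m i < a ∧ S (m i)}
  · rw [Set.indicator_of_mem hm, Set.indicator_of_mem (h.mpr hm)]
    exact Fin.prod_univ_succ _
  · rw [Set.indicator_of_notMem hm, Set.indicator_of_notMem (mt h.mp hm), mul_zero]

theorem tsum_pnat_eq_tsum_nat (f : ℕ → ENNReal) (h0 : f 0 = 0) :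
    ∑' a : ℕ+, f a = ∑' n, f n := by
  rw [tsum_pnat_eq_tsum_succ (f := f), tsum_eq_zero_add' (f := f) ENNReal.summable, h0, zero_add]

theorem tsum_strictAnti_lt (p : List ℕ+) (n : ℕ+) :
    ∑' m, Set.indicator {m : Fin p.length → ℕ+ | StrictAnti m ∧ ∀ i, m i < n} (fun m =>
        ∏ i, ENNReal.ofReal (1 / ((m i : ℕ) : ℝ) ^ ((p.get i : ℕ+) : ℕ))) m
      = ENNReal.ofReal ((partialSum (word (indexWord p)) n).eval 0) := by
  induction p generalizing n with
  | nil =>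
    have hs : (default : Fin ([] : List ℕ+).length → ℕ+) ∈
        {m : Fin ([] : List ℕ+).length → ℕ+ | StrictAnti m ∧ ∀ i, m i < n} :=
      ⟨fun i => i.elim0, fun i => i.elim0⟩
    have h1 : partialSum (word (indexWord [])) n = 1 := by
      change partialSum 1 n = 1
      rw [partialSum_one, if_neg n.ne_zero]
    refine (tsum_eq_single default
      (fun m hm => absurd (_root_.funext fun i => Fin.elim0 i) hm)).trans ?_
    rw [Set.indicator_of_mem hs, h1, Finset.prod_eq_one fun i _ => i.elim0]
    simp
  | cons k p ih =>
    rw [tsum_strictAnti_cons k p (fun a => a < n)]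
    have h1 : ∀ a : ℕ+, ENNReal.ofReal (1 / ((a : ℕ) : ℝ) ^ (k : ℕ))
        * ∑' m, Set.indicator
          {m : Fin p.length → ℕ+ | a < n ∧ StrictAnti m ∧ ∀ i, m i < a ∧ m i < n} (fun m =>
            ∏ i, ENNReal.ofReal (1 / ((m i : ℕ) : ℝ) ^ ((p.get i : ℕ+) : ℕ))) m
        = (fun b : ℕ => if b < (n : ℕ) then
            ENNReal.ofReal ((coef (word (indexWord (k :: p))) b).eval 0) else 0) a := by
      intro a
      simp only [PNat.coe_lt_coe]
      split_ifs with han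
      · rw [eval_zero_coef_cons, ENNReal.ofReal_mul (by positivity), ← ih a]
        have hset : {m : Fin p.length → ℕ+ | a < n ∧ StrictAnti m ∧ ∀ i, m i < a ∧ m i < n}
            = {m | StrictAnti m ∧ ∀ i, m i < a} :=
          Set.ext fun m => ⟨fun h => ⟨h.2.1, fun i => (h.2.2 i).1⟩,
            fun h => ⟨han, h.1, fun i => ⟨h.2 i, (h.2 i).trans han⟩⟩⟩
        rw [hset]
      · simp [han]
    refine (tsum_congr h1).trans ((tsum_pnat_eq_tsum_nat (fun b : ℕ => if b < (n : ℕ) then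
      ENNReal.ofReal ((coef (word (indexWord (k :: p))) b).eval 0) else 0) ?_).trans ?_)
    · simp [eval_zero_coef_cons]
    rw [eval_partialSum, ENNReal.ofReal_sum_of_nonneg, tsum_eq_sum (s := Finset.range n)]
    · exact Finset.sum_congr rfl fun b hb => if_pos (Finset.mem_range.mp hb)
    · exact fun b hb => if_neg (by simpa using hb)
    · exact fun b _ => by rw [coef_word]; exact eval_zero_coefWord_nonneg _ b

/-- No condition `k ≥ 2` is needed: if the series diverges, both real sums take the default value
`0`, as `ENNReal.toReal ∞` does. -/
theorem zeta_cons (k : ℕ+) (p : List ℕ+) :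
    zeta (k :: p) = ∑' n, (coef (word (indexWord (k :: p))) n).eval 0 := by
  have hnn : ∀ n, 0 ≤ (coef (word (indexWord (k :: p))) n).eval 0 := fun n => by
    rw [coef_word]; exact eval_zero_coefWord_nonneg _ n
  have h1 : ∑' n, ENNReal.ofReal ((coef (word (indexWord (k :: p))) n).eval 0)
      = ∑' m : {m : Fin (k :: p).length → ℕ+ // StrictAnti m},
        ENNReal.ofReal (∏ i, 1 / ((m.1 i : ℕ) : ℝ) ^ (((k :: p).get i : ℕ+) : ℕ)) := by
    have h2 := tsum_strictAnti_cons k p (fun _ => True)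
    have h3 := tsum_subtype {m : Fin (k :: p).length → ℕ+ | StrictAnti m} (fun m =>
      ∏ i, ENNReal.ofReal (1 / ((m i : ℕ) : ℝ) ^ (((k :: p).get i : ℕ+) : ℕ)))
    simp only [implies_true, and_true, true_and, tsum_strictAnti_lt] at h2
    calc _ = _ := (tsum_pnat_eq_tsum_nat _ (by simp [eval_zero_coef_cons])).symm
      _ = _ := tsum_congr fun a => by
        rw [eval_zero_coef_cons, ENNReal.ofReal_mul (by positivity)]
      _ = _ := h2.symm
      _ = _ := h3.symm
      _ = _ := tsum_congr fun m => (ENNReal.ofReal_prod_of_nonneg fun _ _ => by positivity).symm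
  have h4 := congrArg ENNReal.toReal h1
  rw [ENNReal.tsum_toReal_eq fun _ => ENNReal.ofReal_ne_top,
    ENNReal.tsum_toReal_eq fun _ => ENNReal.ofReal_ne_top] at h4
  rw [zeta, ← tsum_congr fun n => ENNReal.toReal_ofReal (hnn n), h4]
  exact tsum_congr fun m => (ENNReal.toReal_ofReal
    (Finset.prod_nonneg fun _ _ => by positivity)).symm

/-! ### Interpolated multiple zeta values as sums of coefficients -/

theorem length_le_of_mem_fillings (p q : List ℕ+) (hq : q ∈ fillings p) :
    q.length ≤ p.length := by
  match p with
  | [] => simp_all [fillings]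
  | [k] => simp_all [fillings]
  | k :: l :: p =>
    rw [fillings, List.mem_append, List.mem_map] at hq
    rcases hq with ⟨q, hq, rfl⟩ | hq
    · simpa using length_le_of_mem_fillings _ _ hq
    · exact (length_le_of_mem_fillings _ _ hq).trans (by simp)
  termination_by p.length

theorem exists_cons_of_mem_fillings (k : ℕ+) (p q : List ℕ+) (hq : q ∈ fillings (k :: p)) :
    ∃ l q', q = l :: q' ∧ k ≤ l := by
  match p with
  | [] => exact ⟨k, [], by simpa [fillings] using hq, le_rfl⟩
  | l :: p =>
    rw [fillings, List.mem_append, List.mem_map] at hq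
    rcases hq with ⟨q, hq, rfl⟩ | hq
    · exact ⟨k, q, rfl, le_rfl⟩
    · obtain ⟨i, q', rfl, hi⟩ := exists_cons_of_mem_fillings (k + l) p q hq
      exact ⟨i, q', rfl, le_trans (PNat.coe_le_coe _ _ |>.mp (by simp)) hi⟩
  termination_by p.length

/-- The two summands in the coefficient of `y * w` are the two fillings of a box: `m < n` is the
comma, and the diagonal `m = n` is the plus sign with its factor `t`. -/
theorem coef_eq_sum_fillings (p : List ℕ+) (n : ℕ) :
    coef (word (indexWord p)) n = ((fillings p).map fun q => (X : ℝ[X]) ^ (p.length - q.length)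
      * C ((coef (word (indexWord q)) n).eval 0)).sum := by
  match p with
  | [] =>
    change coef 1 n = _
    have : coef (word (indexWord [])) n = coef 1 n := rfl
    simp only [fillings, List.map_cons, List.map_nil, List.sum_cons, List.sum_nil, this, coef_one]
    split_ifs <;> simp
  | [k] =>
    have : word (indexWord []) = 1 := rfl
    simp only [fillings, List.map_cons, List.map_nil, List.sum_cons, List.sum_nil,
      word_indexWord_cons, coef_z_mul, this, partialSum_one, coef_one]
    rcases Nat.eq_zero_or_pos n with rfl | hn
    · simp
    · simp [hn.ne', ← C_pow]
  | k :: l :: p =>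
    have ih1 := coef_eq_sum_fillings (l :: p)
    have ih2 := coef_eq_sum_fillings ((k + l) :: p) n
    have e1 : coef (word (indexWord (k :: l :: p))) n
        = C ((n : ℝ)⁻¹) ^ (k : ℕ) * partialSum (word (indexWord (l :: p))) n
          + X * coef (word (indexWord ((k + l) :: p))) n := by
      rw [word_indexWord_cons k, coef_z_mul, word_indexWord_cons l, word_indexWord_cons (k + l),
        coef_z_mul l, coef_z_mul (k + l), PNat.add_coe, pow_add]
      ring
    have e2 : partialSum (word (indexWord (l :: p))) n = ((fillings (l :: p)).map fun q =>
        (X : ℝ[X]) ^ ((l :: p).length - q.length)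
          * C ((partialSum (word (indexWord q)) n).eval 0)).sum := by
      rw [partialSum_apply, Finset.sum_congr rfl fun m _ => ih1 m]
      induction fillings (l :: p) with
      | nil => simp
      | cons q Q ihQ =>
        simp only [List.map_cons, List.sum_cons, Finset.sum_add_distrib, ihQ, ← Finset.mul_sum]
        rw [eval_partialSum, map_sum]
    rw [e1, e2, ih2, fillings, List.map_append, List.sum_append, List.map_map,
      ← List.sum_map_mul_left, ← List.sum_map_mul_left]
    congr 2
    · refine List.map_congr_left fun q _ => ?_
      simp only [Function.comp_apply, eval_zero_coef_cons, List.length_cons, Nat.add_sub_add_right,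
        C_mul]
      simp only [one_div, ← inv_pow, C_pow]
      ring
    · refine List.map_congr_left fun q hq => ?_
      have := length_le_of_mem_fillings _ _ hq
      rw [← mul_assoc, ← pow_succ']
      congr 2
      simp only [List.length_cons] at this ⊢
      omega
  termination_by p.length

theorem mem_H0_cons (k : ℕ+) (p : List ℕ+) : word (indexWord ((k + 1) :: p)) ∈ H0 := by
  rw [indexWord_cons, zWord_add_one, List.cons_append, ← indexWord_cons, word_cons]
  exact x_mul_mem_H0 (word_indexWord_mem_Hy k p)

theorem hasSum_coef_word (τ : ℝ) (k : ℕ+) (p : List ℕ+) :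
    HasSum (fun n => (coef (word (indexWord ((k + 1) :: p))) n).eval τ)
      ((zetaT ((k + 1) :: p)).eval τ) := by
  simp only [coef_eq_sum_fillings ((k + 1) :: p), zetaT]
  have key : ∀ q ∈ fillings ((k + 1) :: p),
      HasSum (fun n => (coef (word (indexWord q)) n).eval 0) (zeta q) := by
    intro q hq
    obtain ⟨l, q, rfl, hl⟩ := exists_cons_of_mem_fillings _ _ _ hq
    -- Merging only increases the first entry, so each filling is again convergent.
    obtain ⟨i, rfl⟩ : ∃ i, l = i + 1 := PNat.exists_eq_succ_of_ne_one (by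
      rintro rfl
      exact absurd hl (not_le.mpr (PNat.lt_add_left 1 k)))
    rw [zeta_cons]
    exact (summable_coef 0 (mem_H0_cons i q)).hasSum
  generalize fillings ((k + 1) :: p) = Q at key ⊢
  induction Q with
  | nil => simp
  | cons q Q ih =>
    simp only [List.map_cons, List.sum_cons, eval_add, eval_mul, eval_C]
    exact ((key q (by simp)).mul_left _).add (ih fun q hq => key q (by simp [hq]))

theorem hasSum_coef (τ : ℝ) (u : H0) :
    HasSum (fun n => (coef (u : H) n).eval τ) ((Zt u).eval τ) := by
  obtain ⟨u, hu⟩ := u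
  suffices ∃ h : u ∈ H0, HasSum (fun n => (coef u n).eval τ) ((Zt ⟨u, h⟩).eval τ) from
    this.choose_spec
  refine H0_induction
    (P := fun u => ∃ h : u ∈ H0, HasSum (fun n => (coef u n).eval τ) ((Zt ⟨u, h⟩).eval τ))
    ⟨H0.zero_mem, ?_⟩ ?_ ?_ ⟨one_mem_H0, ?_⟩ (fun k p => ⟨mem_H0_cons k p, ?_⟩) hu
  · have : (⟨0, H0.zero_mem⟩ : H0) = 0 := rfl
    simp [this]
  · rintro a b ⟨ha, ha'⟩ ⟨hb, hb'⟩
    refine ⟨H0.add_mem ha hb, ?_⟩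
    have : (⟨a + b, H0.add_mem ha hb⟩ : H0) = ⟨a, ha⟩ + ⟨b, hb⟩ := rfl
    rw [this, map_add, map_add, eval_add]
    simpa only [Pi.add_apply, eval_add] using ha'.add hb'
  · rintro c a ⟨ha, ha'⟩
    refine ⟨H0.smul_mem c ha, ?_⟩
    have : (⟨c • a, H0.smul_mem c ha⟩ : H0) = c • ⟨a, ha⟩ := rfl
    rw [this, map_smul, map_smul, ratPoly_smul_def, eval_mul]
    simpa only [Pi.smul_apply, ratPoly_smul_def, eval_mul] using ha'.mul_left ((c.map (algebraMap ℚ ℝ)).eval τ)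
  · rw [Zt_one, eval_one]
    convert hasSum_ite_eq (0 : ℕ) (1 : ℝ) using 2 with n
    rw [coef_one]
    split_ifs <;> simp
  · rw [Zt_word]
    exact hasSum_coef_word τ k p

/-! ### The realization of the harmonic product by partial sums -/

/-- The partial sums of the coefficients at the value `τ` of `t`. -/
def truncatedValue (u : H) (τ : ℝ) (n : ℕ) : ℝ := (partialSum u n).eval τ

theorem eval_coef_y (τ : ℝ) (n : ℕ) : (coef (letter Letter.y) n).eval τ = (n : ℝ)⁻¹ := by
  rw [← mul_one (letter Letter.y), eval_coef_y_mul, partialSum_one, coef_one]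
  rcases Nat.eq_zero_or_pos n with rfl | hn
  · simp
  · simp [hn.ne']

theorem hasExpansion_truncatedValue (u : H0) :
    HasExpansion harmonicSum (truncatedValue u) (C (Zt u)) := by
  intro τ j
  simp only [truncatedValue, map_C, eval_C, coe_evalRingHom]
  refine squeeze_zero_norm (fun n => ?_)
    (tendsto_sum_nat_add fun n => |(coef (u : H) n).eval τ| * (1 + harmonicSum n) ^ j)
  have hs := hasSum_coef τ u
  have h1 : (partialSum (u : H) n).eval τ - (Zt u).eval τ
      = -∑' m, (coef (u : H) (m + n)).eval τ := by
    rw [eval_partialSum, ← hs.tsum_eq, ← hs.summable.sum_add_tsum_nat_add n]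
    ring
  have h2 := (summable_nat_add_iff n).mpr (summable_coef_mul_pow τ u.2 j)
  have h3 : Summable fun m => ‖(coef (u : H) (m + n)).eval τ‖ :=
    (summable_nat_add_iff n).mpr hs.summable.norm
  have h0 := harmonicSum_nonneg n
  rw [h1, norm_mul, norm_neg, norm_pow, Real.norm_of_nonneg h0]
  refine (mul_le_mul_of_nonneg_right (norm_tsum_le_tsum_norm h3) (by positivity)).trans ?_
  rw [← tsum_mul_right]
  refine (h3.mul_right _).tsum_le_tsum (fun m => ?_) h2
  -- By monotonicity the power of `harmonicSum n` moves inside the tail, which becomes the tail of a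
  -- convergent series.
  have h4 := harmonicSum_mono (Nat.le_add_left n m)
  have h5 : harmonicSum n ≤ 1 + harmonicSum (m + n) := by linarith
  exact mul_le_mul_of_nonneg_left (pow_le_pow_left₀ h0 h5 j) (abs_nonneg _)

theorem isRealization_truncatedValue : IsRealization tastH harmonicSum truncatedValue where
  tendsto := tendsto_harmonicSum
  map_add u v := by
    funext τ n
    simp [truncatedValue]
  map_smul c u τ n := by
    simp [truncatedValue, ratPoly_smul_def]
  map_mul u hu v hv := by
    funext τ n
    simp [truncatedValue, partialSum_tastH hu hv]
  map_y τ := by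
    funext n
    simp only [truncatedValue, eval_partialSum, eval_coef_y, harmonicSum]
  of_H0 := hasExpansion_truncatedValue

/-! ### The realization of the shuffle product by polylogarithms -/

/-- A sequence that tends to `1` from below, at which `-log(1 - s)` is a positive integer. -/
def node (N : ℕ) : ℝ := 1 - Real.exp (-((N : ℝ) + 1))

theorem node_pos (N : ℕ) : 0 < node N := by
  have : Real.exp (-((N : ℝ) + 1)) < 1 := Real.exp_lt_one_iff.mpr (by linarith [N.cast_nonneg (α := ℝ)])
  rw [node]; linarith

theorem node_lt_one (N : ℕ) : node N < 1 := by
  have := Real.exp_pos (-((N : ℝ) + 1))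
  rw [node]; linarith

theorem tendsto_node : Tendsto node atTop (𝓝[<] 1) := by
  refine tendsto_nhdsWithin_iff.mpr ⟨?_, Eventually.of_forall node_lt_one⟩
  have h : Tendsto (fun N : ℕ => (N : ℝ) + 1) atTop atTop :=
    tendsto_natCast_atTop_atTop.atTop_add tendsto_const_nhds
  have := (Real.tendsto_exp_neg_atTop_nhds_zero.comp h).const_sub 1
  rwa [sub_zero] at this

/-- The values of the interpolated multiple polylogarithms at the nodes. -/
def polylogValue (u : H) (τ : ℝ) (N : ℕ) : ℝ := ∑' n, (coef u n).eval τ * node N ^ n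

theorem summable_coef_mul_pow_node (u : H) (τ : ℝ) (N : ℕ) :
    Summable fun n => ‖(coef u n).eval τ * node N ^ n‖ := by
  induction u using word_induction with
  | h0 => simp
  | hadd u v hu hv =>
    refine (hu.add hv).of_nonneg_of_le (fun _ => norm_nonneg _) fun n => ?_
    rw [map_add, Pi.add_apply, eval_add, add_mul]
    exact norm_add_le _ _
  | hsmul c u hu =>
    refine (hu.mul_left ‖(c.map (algebraMap ℚ ℝ)).eval τ‖).congr fun n => ?_
    rw [map_smul, Pi.smul_apply, ratPoly_smul_def, eval_mul, ← norm_mul, mul_assoc]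
  | hword w =>
    obtain ⟨K, hK, h⟩ := exists_bound_word τ w
    obtain ⟨K', h'⟩ := exists_pow_le_rpow w.length
    have hs := node_pos N
    have hsum : Summable fun n : ℕ => K * K' * ((n : ℝ) ^ 1 * node N ^ n) :=
      (summable_pow_mul_geometric_of_norm_lt_one (R := ℝ) 1 (r := node N) (by
        rw [Real.norm_of_nonneg hs.le]; exact node_lt_one N)).mul_left _
    refine Summable.of_norm_bounded_eventually_nat hsum ?_
    filter_upwards [eventually_ge_atTop 1] with n hn
    have hn' : (1 : ℝ) ≤ n := by exact_mod_cast hn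
    rw [norm_norm, norm_mul, Real.norm_of_nonneg (by positivity : 0 ≤ node N ^ n),
      ← mul_assoc, pow_one]
    refine mul_le_mul_of_nonneg_right ?_ (by positivity)
    have h1 : |(coef (word w) n).eval τ| ≤ n * |(coef (word w) n).eval τ| :=
      le_mul_of_one_le_left (abs_nonneg _) hn'
    have h2 := mul_le_mul_of_nonneg_left (h' n hn) hK
    have h3 : 0 ≤ K' := by
      have h0 := harmonicSum_nonneg n
      have := (pow_nonneg (by linarith) w.length).trans (h' n hn)
      exact nonneg_of_mul_nonneg_left this (by positivity)
    have h4 : (n : ℝ) ^ (1 / 4 : ℝ) ≤ n :=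
      (Real.rpow_le_rpow_of_exponent_le hn' (by norm_num)).trans (Real.rpow_one _).le
    have h5 := mul_le_mul_of_nonneg_left h4 (mul_nonneg hK h3)
    rw [Real.norm_eq_abs]
    linarith [(h n).2]

theorem summable_node (u : H) (τ : ℝ) (N : ℕ) :
    Summable fun n => (coef u n).eval τ * node N ^ n :=
  (summable_coef_mul_pow_node u τ N).of_norm

theorem polylogValue_add (u v : H) (τ : ℝ) (N : ℕ) :
    polylogValue (u + v) τ N = polylogValue u τ N + polylogValue v τ N := by
  rw [polylogValue, polylogValue, polylogValue,
    ← (summable_node u τ N).tsum_add (summable_node v τ N)]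
  exact tsum_congr fun n => by rw [map_add, Pi.add_apply, eval_add, add_mul]

theorem polylogValue_tshuffleH {u v : H} (hu : u ∈ H1) (hv : v ∈ H1) (τ : ℝ) (N : ℕ) :
    polylogValue (tshuffleH u v) τ N = polylogValue u τ N * polylogValue v τ N := by
  rw [polylogValue, polylogValue, polylogValue,
    tsum_mul_tsum_eq_tsum_sum_antidiagonal_of_summable_norm (R := ℝ)
      (summable_coef_mul_pow_node u τ N) (summable_coef_mul_pow_node v τ N)]
  refine tsum_congr fun n => ?_
  rw [← coeff_genSeries, genSeries_tshuffleH hu hv, PowerSeries.coeff_mul, eval_finsetSum,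
    Finset.sum_mul]
  refine Finset.sum_congr rfl fun ij hij => ?_
  rw [← Finset.HasAntidiagonal.mem_antidiagonal.mp hij, eval_mul, coeff_genSeries, coeff_genSeries, pow_add]
  ring

theorem polylogValue_y (τ : ℝ) (N : ℕ) : polylogValue (letter Letter.y) τ N = N + 1 := by
  have h1 := Real.hasSum_pow_div_log_of_abs_lt_one (x := node N)
    (by rw [abs_of_pos (node_pos N)]; exact node_lt_one N)
  have h2 : -Real.log (1 - node N) = N + 1 := by
    rw [node, sub_sub_cancel, Real.log_exp, neg_neg]
  rw [h2] at h1
  rw [polylogValue, (summable_node _ τ N).tsum_eq_zero_add, ← h1.tsum_eq]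
  simp only [eval_coef_y]
  rw [Nat.cast_zero, inv_zero, zero_mul, zero_add]
  refine tsum_congr fun n => ?_
  push_cast
  rw [div_eq_inv_mul]

/-- An interpolation between Bernoulli's bound `n * (1 - s)` and the trivial bound `1`: the
available decay of the coefficients need not make them summable against `n`, but it does against `n
^ (1 / 4)`. -/
theorem one_sub_pow_le {s : ℝ} (h0 : 0 ≤ s) (h1 : s ≤ 1) (n : ℕ) :
    1 - s ^ n ≤ (n : ℝ) ^ (1 / 4 : ℝ) * (1 - s) ^ (1 / 4 : ℝ) := by
  have h2 : 1 - s ^ n ≤ n * (1 - s) := by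
    have := one_add_mul_le_pow (a := s - 1) (by linarith) n
    rw [add_sub_cancel] at this
    linarith
  have h3 : 0 ≤ 1 - s ^ n := by linarith [pow_le_one₀ (n := n) h0 h1]
  have h4 : 1 - s ^ n ≤ 1 := by linarith [pow_nonneg h0 n]
  rw [← Real.mul_rpow (by positivity) (by linarith)]
  exact (Real.self_le_rpow_of_le_one h3 h4 (by norm_num)).trans
    (Real.rpow_le_rpow h3 h2 (by norm_num))

theorem rapidlyVanishes_exp :
    RapidlyVanishes (fun N : ℕ => (N : ℝ) + 1) fun N => Real.exp (-((N : ℝ) + 1)) ^ (1 / 4 : ℝ) := by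
  intro j
  have h : Tendsto (fun N : ℕ => ((N : ℝ) + 1) / 4) atTop atTop :=
    (tendsto_natCast_atTop_atTop.atTop_add tendsto_const_nhds).atTop_div_const (by norm_num)
  have := ((Real.tendsto_pow_mul_exp_neg_atTop_nhds_zero j).comp h).const_mul ((4 : ℝ) ^ j)
  rw [mul_zero] at this
  refine this.congr fun N => ?_
  simp only [Function.comp_apply]
  rw [← Real.exp_mul, ← mul_assoc, ← mul_pow, mul_div_cancel₀ _ (by norm_num), mul_comm]
  congr 2
  ring

theorem hasExpansion_polylogValue (u : H0) :
    HasExpansion (fun N => (N : ℝ) + 1) (polylogValue u) (C (Zt u)) := by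
  intro τ j
  simp only [map_C, eval_C, coe_evalRingHom]
  have hsum := summable_coef_mul_rpow τ u.2
  set K := ∑' n : ℕ, |(coef (u : H) n).eval τ| * (n : ℝ) ^ (1 / 4 : ℝ) with hK
  have hlim := (rapidlyVanishes_exp j).const_mul K
  rw [mul_zero] at hlim
  refine squeeze_zero_norm (fun N => ?_) hlim
  have hs := hasSum_coef τ u
  have h1 : polylogValue (u : H) τ N - (Zt u).eval τ
      = -∑' n, (coef (u : H) n).eval τ * (1 - node N ^ n) := by
    rw [polylogValue, ← hs.tsum_eq, ← neg_sub, ← hs.summable.tsum_sub (summable_node _ τ N)]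
    simp only [mul_sub, mul_one]
  have h2 : ∀ n : ℕ, ‖(coef (u : H) n).eval τ * (1 - node N ^ n)‖
      ≤ |(coef (u : H) n).eval τ| * (n : ℝ) ^ (1 / 4 : ℝ)
        * Real.exp (-((N : ℝ) + 1)) ^ (1 / 4 : ℝ) := by
    intro n
    have h3 := one_sub_pow_le (node_pos N).le (node_lt_one N).le n
    have h4 : 0 ≤ 1 - node N ^ n := by
      linarith [pow_le_one₀ (n := n) (node_pos N).le (node_lt_one N).le]
    have h5 : 1 - node N = Real.exp (-((N : ℝ) + 1)) := by rw [node, sub_sub_cancel]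
    rw [norm_mul, Real.norm_of_nonneg h4, mul_assoc, ← h5]
    exact mul_le_mul_of_nonneg_left h3 (norm_nonneg _)
  rw [h1, norm_mul, norm_neg, norm_pow, Real.norm_of_nonneg (by positivity : 0 ≤ (N : ℝ) + 1),
    ← mul_assoc]
  refine mul_le_mul_of_nonneg_right ?_ (by positivity)
  rw [hK, ← tsum_mul_right]
  exact tsum_of_norm_bounded (hsum.mul_right _).hasSum h2

theorem isRealization_polylogValue :
    IsRealization tshuffleH (fun N => (N : ℝ) + 1) polylogValue where
  tendsto := tendsto_natCast_atTop_atTop.atTop_add tendsto_const_nhds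
  map_add u v := by
    funext τ n
    exact polylogValue_add u v τ n
  map_smul c u τ N := by
    rw [polylogValue, polylogValue, ← tsum_mul_left]
    exact tsum_congr fun n => by
      rw [map_smul, Pi.smul_apply, ratPoly_smul_def, eval_mul, mul_assoc]
  map_mul u hu v hv := by
    funext τ n
    exact polylogValue_tshuffleH hu hv τ n
  map_y τ := by
    funext N
    exact polylogValue_y τ N
  of_H0 := hasExpansion_polylogValue

/-! ### Comparison of the two realizations -/

/-- Multiplication by the geometric series `1 / (1 - s)` replaces the coefficients by their partial
sums. -/
theorem tsum_nonneg_of_partialSums_nonneg {c : ℕ → ℝ} {s : ℝ} (h0 : 0 < s) (h1 : s < 1)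
    (hc : Summable fun n => ‖c n * s ^ n‖) (hC : ∀ n, 0 ≤ ∑ m ∈ Finset.range n, c m) :
    0 ≤ ∑' n, c n * s ^ n := by
  have hg : Summable fun n => ‖s ^ n‖ := by
    simpa only [norm_pow, Real.norm_of_nonneg h0.le] using summable_geometric_of_lt_one h0.le h1
  have h2 := tsum_mul_tsum_eq_tsum_sum_antidiagonal_of_summable_norm (R := ℝ) hc hg
  rw [tsum_geometric_of_lt_one h0.le h1] at h2
  refine nonneg_of_mul_nonneg_left (b := (1 - s)⁻¹) ?_ (inv_pos.mpr (by linarith))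
  rw [h2]
  refine tsum_nonneg fun n => ?_
  rw [Finset.Nat.sum_antidiagonal_eq_sum_range_succ_mk]
  have h3 : ∀ m ∈ Finset.range (n + 1), c m * s ^ m * s ^ (n - m) = c m * s ^ n := by
    intro m hm
    rw [mul_assoc, ← pow_add, Nat.add_sub_cancel' (Nat.lt_succ_iff.mp (Finset.mem_range.mp hm))]
  rw [Finset.sum_congr rfl h3, ← Finset.sum_mul]
  exact mul_nonneg (hC _) (by positivity)

/-- The partial sums are capped at `1`. The capped series has limit `1` by Abel's theorem and lies
below the original one by `tsum_nonneg_of_partialSums_nonneg`. -/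
theorem not_tendsto_zero_of_partialSums_atTop {a : ℕ → ℝ}
    (ha : ∀ N, Summable fun n => ‖a n * node N ^ n‖)
    (hA : Tendsto (fun n => ∑ m ∈ Finset.range n, a m) atTop atTop) :
    ¬ Tendsto (fun N => ∑' n, a n * node N ^ n) atTop (𝓝 0) := by
  intro h
  set A : ℕ → ℝ := fun n => ∑ m ∈ Finset.range n, a m with hAdef
  set b : ℕ → ℝ := fun n => min (A (n + 1)) 1 - min (A n) 1 with hbdef
  have hB : ∀ n, ∑ m ∈ Finset.range n, b m = min (A n) 1 := by
    intro n
    rw [Finset.sum_range_sub (fun n => min (A n) 1)]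
    simp [hAdef]
  have hb : ∀ N, Summable fun n => ‖b n * node N ^ n‖ := by
    intro N
    refine (ha N).of_nonneg_of_le (fun _ => norm_nonneg _) fun n => ?_
    rw [norm_mul, norm_mul]
    refine mul_le_mul_of_nonneg_right ?_ (norm_nonneg _)
    have h1 : a n = A (n + 1) - A n := by simp [hAdef, Finset.sum_range_succ]
    rw [h1, Real.norm_eq_abs, Real.norm_eq_abs]
    refine (abs_min_sub_min_le_max _ _ _ _).trans ?_
    simp
  have hlim : Tendsto (fun n => ∑ m ∈ Finset.range n, b m) atTop (𝓝 1) := by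
    refine tendsto_const_nhds.congr' ?_
    filter_upwards [hA.eventually_ge_atTop 1] with n hn
    rw [hB, min_eq_right hn]
  have hG := (Real.tendsto_tsum_powerSeries_nhdsWithin_lt hlim).comp tendsto_node
  have hle : ∀ N, ∑' n, b n * node N ^ n ≤ ∑' n, a n * node N ^ n := by
    intro N
    rw [← sub_nonneg, ← (ha N).of_norm.tsum_sub (hb N).of_norm]
    simp only [← sub_mul]
    refine tsum_nonneg_of_partialSums_nonneg (node_pos N) (node_lt_one N) ?_ fun n => ?_
    · refine ((ha N).add (hb N)).of_nonneg_of_le (fun _ => norm_nonneg _) fun n => ?_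
      rw [sub_mul]
      exact norm_sub_le _ _
    · rw [Finset.sum_sub_distrib, hB, sub_nonneg]
      exact min_le_left _ _
  exact absurd (le_of_tendsto_of_tendsto' hG h hle) (by norm_num)

theorem tendsto_polylogValue {u : H} {τ l : ℝ}
    (h : Tendsto (truncatedValue u τ) atTop (𝓝 l)) :
    Tendsto (polylogValue u τ) atTop (𝓝 l) := by
  refine (Real.tendsto_tsum_powerSeries_nhdsWithin_lt (h.congr fun n => ?_)).comp tendsto_node
  rw [truncatedValue, eval_partialSum]

theorem not_tendsto_polylogValue {u : H} {τ : ℝ} (h : Tendsto (truncatedValue u τ) atTop atTop) :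
    ¬ Tendsto (polylogValue u τ) atTop (𝓝 0) :=
  not_tendsto_zero_of_partialSums_atTop (summable_coef_mul_pow_node u τ)
    (h.congr fun n => by rw [truncatedValue, eval_partialSum])

theorem tendsto_truncatedValue_atTop {u : H} {P : RtT}
    (h : HasExpansion harmonicSum (truncatedValue u) P) {τ : ℝ}
    (hd : 0 < (P.map (evalRingHom τ)).degree)
    (hl : 0 ≤ (P.map (evalRingHom τ)).leadingCoeff) :
    Tendsto (truncatedValue u τ) atTop atTop := by
  have h1 := (Polynomial.tendsto_atTop_of_leadingCoeff_nonneg _ hd hl).comp tendsto_harmonicSum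
  refine ((h τ).tendsto.add_atTop h1).congr fun n => ?_
  simp

/-- This transfers the relations from the shuffle to the harmonic regularization. For each `τ`, a
constant expansion is evaluated by Abel's theorem; a nonconstant one sends the partial sums of `u`
or `-u` to `+∞`, against the limit `0` of the polylogarithm. -/
theorem HasExpansion.eq_zero_of_polylogValue {u : H} {P : RtT}
    (h : HasExpansion harmonicSum (truncatedValue u) P)
    (h0 : HasExpansion (fun N => (N : ℝ) + 1) (polylogValue u) 0) : P = 0 := by
  refine eq_zero_of_map_evalRingHom fun τ => ?_
  have hlim : Tendsto (polylogValue u τ) atTop (𝓝 0) := by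
    simpa using (h0 τ).tendsto
  rcases le_or_gt (P.map (evalRingHom τ)).degree 0 with hd | hd
  · rw [eq_C_of_degree_le_zero hd]
    have h1 := (h τ).tendsto
    rw [eq_C_of_degree_le_zero hd] at h1
    simp only [eval_C] at h1
    have h2 := h1.add_const ((P.map (evalRingHom τ)).coeff 0)
    simp only [sub_add_cancel, zero_add] at h2
    rw [tendsto_nhds_unique (tendsto_polylogValue h2) hlim, C_0]
  · exfalso
    rcases le_total 0 (P.map (evalRingHom τ)).leadingCoeff with hl | hl
    · exact not_tendsto_polylogValue (tendsto_truncatedValue_atTop h hd hl) hlim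
    · have hneg : HasExpansion harmonicSum (truncatedValue (-u)) (-P) := by
        intro τ j
        have := (h τ j).neg
        rw [neg_zero] at this
        refine this.congr fun n => ?_
        simp only [truncatedValue, map_neg, Pi.neg_apply, eval_neg, Polynomial.map_neg]
        ring
      refine not_tendsto_polylogValue (tendsto_truncatedValue_atTop (τ := τ) hneg ?_ ?_) ?_
      · rwa [Polynomial.map_neg, degree_neg]
      · rw [Polynomial.map_neg, leadingCoeff_neg]
        linarith
      · have := hlim.neg
        rw [neg_zero] at this
        refine this.congr fun N => ?_
        simp only [polylogValue, map_neg, Pi.neg_apply, eval_neg, neg_mul]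
        rw [tsum_neg]

theorem polylog_expansion_tast {Zsh Zast : H1 →ₗ[ℚ[X]] RtT}
    (hsh : ∀ u : H1, HasExpansion (fun N => (N : ℝ) + 1) (polylogValue u) (Zsh u))
    (hast : ∀ u : H1, HasExpansion harmonicSum (truncatedValue u) (Zast u))
    (w₁ : H1) (w₀ : H0) : Zsh (tast w₁ (toH1 w₀)) = Zsh w₁ * C (Zt w₀) := by
  rw [← sub_eq_zero]
  refine eq_zero_of_tendsto_map_eval isRealization_polylogValue.tendsto fun τ => ?_
  set c : ℝ := (Zt w₀).eval τ with hc
  set v : H := tastH w₁ w₀ with hv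
  -- The main terms `Zast w₁ * Zt w₀` cancel, so only rapidly vanishing errors are left.
  have h1 : Tendsto (fun n => truncatedValue v τ n - c * truncatedValue w₁ τ n) atTop (𝓝 0) := by
    have h2 := ((hast w₁).mul (isRealization_truncatedValue.of_H0 w₀) τ).tendsto
    have h3 := ((hast w₁ τ).tendsto.const_mul c)
    have h4 := h2.sub h3
    rw [mul_zero, sub_zero] at h4
    refine h4.congr fun n => ?_
    have h5 : truncatedValue v = truncatedValue w₁ * truncatedValue (w₀ : H) :=
      isRealization_truncatedValue.map_mul _ w₁.2 _ (H0_le_H1 w₀.2)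
    rw [h5]
    simp only [Pi.mul_apply, Polynomial.map_mul, map_C, eval_mul, eval_C, coe_evalRingHom]
    ring
  have h2 : Tendsto (fun N => polylogValue v τ N - c * polylogValue w₁ τ N) atTop (𝓝 0) := by
    have h3 : Tendsto (fun n => ∑ m ∈ Finset.range n,
        ((coef v m).eval τ - c * (coef (w₁ : H) m).eval τ)) atTop (𝓝 0) := by
      refine h1.congr fun n => ?_
      rw [Finset.sum_sub_distrib, ← Finset.mul_sum, truncatedValue, truncatedValue,
        eval_partialSum, eval_partialSum]
    refine ((Real.tendsto_tsum_powerSeries_nhdsWithin_lt h3).comp tendsto_node).congr fun N => ?_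
    rw [polylogValue, polylogValue, ← tsum_mul_left,
      ← (summable_node v τ N).tsum_sub ((summable_node _ τ N).mul_left c)]
    exact tsum_congr fun n => by ring
  have h3 := (hsh (tast w₁ (toH1 w₀)) τ).tendsto
  have h4 := (hsh w₁ τ).tendsto.const_mul c
  have h5 := (h2.sub h3).add h4
  rw [mul_zero, sub_zero, add_zero] at h5
  refine h5.congr fun N => ?_
  have h6 : ((tast w₁ (toH1 w₀) : H1) : H) = v := rfl
  rw [h6]
  simp only [Polynomial.map_sub, Polynomial.map_mul, map_C, eval_sub, eval_mul, eval_C,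
    coe_evalRingHom]
  ring

end

end TMZV

/-! ### The extended double shuffle relations -/

theorem mainTheorem1 :
    ∃ Zsh Zast : TMZV.H1 →ₗ[Polynomial ℚ] TMZV.RtT,
      (TMZV.IsRegularization TMZV.tshuffle Zsh ∧
        ∀ Z, TMZV.IsRegularization TMZV.tshuffle Z → Z = Zsh) ∧
      (TMZV.IsRegularization TMZV.tast Zast ∧
        ∀ Z, TMZV.IsRegularization TMZV.tast Z → Z = Zast) ∧
      ∀ (w₁ : TMZV.H1) (w₀ : TMZV.H0),
        Zsh (TMZV.tshuffle w₁ (TMZV.toH1 w₀) - TMZV.tast w₁ (TMZV.toH1 w₀)) = 0 ∧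
        Zast (TMZV.tshuffle w₁ (TMZV.toH1 w₀) - TMZV.tast w₁ (TMZV.toH1 w₀)) = 0 := by
  obtain ⟨Zsh, hsh, esh⟩ := TMZV.isRealization_polylogValue.exists_regularization
    TMZV.isRaising_tshuffleH (mul' := TMZV.tshuffle) fun _ _ => rfl
  obtain ⟨Zast, hast, east⟩ := TMZV.isRealization_truncatedValue.exists_regularization
    TMZV.isRaising_tastH (mul' := TMZV.tast) fun _ _ => rfl
  refine ⟨Zsh, Zast, ⟨hsh, fun Z hZ => hZ.unique TMZV.isRaising_tshuffleH (fun _ _ => rfl) hsh⟩,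
    ⟨hast, fun Z hZ => hZ.unique TMZV.isRaising_tastH (fun _ _ => rfl) hast⟩, fun w₁ w₀ => ?_⟩
  have h0 : Zsh (TMZV.tshuffle w₁ (TMZV.toH1 w₀) - TMZV.tast w₁ (TMZV.toH1 w₀)) = 0 := by
    have hsub : ∀ a b : TMZV.H1, Zsh (a - b) = Zsh a - Zsh b := by
      intro a b
      rw [eq_sub_iff_add_eq, ← LinearMap.map_add]
      congr 1
      exact Subtype.ext (sub_add_cancel (a : TMZV.H) b)
    rw [hsub, hsh.map_mul, hsh.restrict, TMZV.polylog_expansion_tast esh east, sub_self]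
  refine ⟨h0, (east _).eq_zero_of_polylogValue ?_⟩
  rw [← h0]
  exact esh _
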